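/- Let $\Gamma$ be a finite group, regarded as a discrete topological group. For a non-archimedean local field $K$ (of any characteristic) let $G_K=\mathrm{Gal}(K^{\mathrm{sep}}/K)$ be its absolute Galois group, $I_K\subset G_K$ its inertia subgroup, and $q_K$ the cardinality of its residue field; let $S_{K,\Gamma}$ be the set of continuous homomorphisms $\rho\colon G_K\to\Gamma$. A \emph{counting function} for $\Gamma$ is a function $c$ assigning to every $\rho\in S_{K,\Gamma}$, for all local fields $K$, an integer $c(\rho)\ge 0$, such that $c(\gamma\rho\gamma^{-1})=c(\rho)$ for all $\gamma\in\Gamma$. It is \emph{proper} if $c(\rho)=c(\rho')$ whenever $\rho\in S_{K,\Gamma}$ and $\rho'\in S_{K',\Gamma}$ satisfy $\rho(I_K)=\rho'(I_{K'})$ and both $q_K$ and $q_{K'}$ are relatively prime to $|\Gamma|$. Put $$M(K,\Gamma,c)=\sum_{\rho\in S_{K,\Gamma}}\frac{1}{q_K^{c(\rho)}}\in[0,\infty].$$ For a class $S$ of local fields, $(\Gamma,c)$ \emph{has a mass formula for $S$} if there is a polynomial $f\in\mathbb{Z}[x]$ such that $M(K,\Gamma,c)=f(1/q_K)$ (in particular,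 the mass is finite) for all $K\in S$. \textbf{Proposition.} Let $c$ be a proper counting function for $\Gamma$. Then $(\Gamma,c)$ has a mass formula for the class of all local fields $K$ with $q_K$ relatively prime to $|\Gamma|$ if and only if $\Gamma$ has a rational character table, that is, all values of all irreducible complex characters of $\Gamma$ are rational. -/

import Mathlib

open scoped ValuativeRel ENNReal

universe u v

/-- The absolute Galois group `G_K = Gal(K^sep/K)`, with its Krull topology. -/
abbrev AbsGal (K : Type u) [Field K] : Type u := Gal(SeparableClosure K/K)

/-- The inertia subgroup `I_K` of `G_K` for a (non-archimedean) local field `K`: the automorphisms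
acting trivially on the residue field of the ring of integers `O` of `K^sep`, where `O` is the
integral closure of `𝒪[K]` in `K^sep`. As `𝒪[K]` is a complete discrete valuation ring, `O` is a
local ring, so that its Jacobson radical is its maximal ideal. -/
noncomputable def inertiaGroup (K : Type u) [Field K] [ValuativeRel K] [TopologicalSpace K]
    [IsNonarchimedeanLocalField K] : Subgroup (AbsGal K) :=
  (Ring.jacobson (integralClosure 𝒪[K] (SeparableClosure K))).inertia (AbsGal K)

/-- The number `q_K` of elements of the residue field of a local field `K`. -/
noncomputable def residueCard (K : Type u) [Field K] [ValuativeRel K] [TopologicalSpace K]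
    [IsNonarchimedeanLocalField K] : ℕ :=
  Nat.card 𝓀[K]

/-- A counting function for `Γ`: it assigns a natural number to every continuous homomorphism
`G_K → Γ`, for all local fields `K`, and is invariant under conjugation by elements of `Γ`.
(Invariance under isomorphisms of `K` is not demanded; a function that is only given on one
representative of every isomorphism class of local fields extends to all of them by transport.) -/
structure CountingFunction (Γ : Type v) [Group Γ] [TopologicalSpace Γ] where
  /-- the value `c(ρ)` -/
  toFun : ∀ {K : Type u} [Field K] [ValuativeRel K] [TopologicalSpace K]
    [IsNonarchimedeanLocalField K], (AbsGal K →ₜ* Γ) → ℕ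
  /-- `c(γ ρ γ⁻¹) = c(ρ)` -/
  conj_invariant : ∀ {K : Type u} [Field K] [ValuativeRel K] [TopologicalSpace K]
    [IsNonarchimedeanLocalField K] (γ : Γ) (ρ ρ' : AbsGal K →ₜ* Γ),
    (∀ s, ρ' s = γ * ρ s * γ⁻¹) → toFun ρ' = toFun ρ

namespace CountingFunction

variable {Γ : Type v} [Group Γ] [TopologicalSpace Γ]

/-- `c` is proper: for local fields whose residue cardinality is prime to `|Γ|`, the value `c(ρ)`
depends only on the image of inertia `ρ(I_K)`, a subgroup of `Γ`. -/
def IsProper (c : CountingFunction.{u, v} Γ) : Prop :=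
  ∀ (K K' : Type u) [Field K] [ValuativeRel K] [TopologicalSpace K] [IsNonarchimedeanLocalField K]
    [Field K'] [ValuativeRel K'] [TopologicalSpace K'] [IsNonarchimedeanLocalField K']
    (ρ : AbsGal K →ₜ* Γ) (ρ' : AbsGal K' →ₜ* Γ),
    (residueCard K).Coprime (Nat.card Γ) → (residueCard K').Coprime (Nat.card Γ) →
    (inertiaGroup K).map (ρ : AbsGal K →* Γ) = (inertiaGroup K').map (ρ' : AbsGal K' →* Γ) →
    c.toFun ρ = c.toFun ρ'

/-- The total mass `M(K, Γ, c) = ∑_ρ q_K ^ (-c(ρ))`, the sum being over all continuous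
homomorphisms `ρ : G_K → Γ`; it is `∞` if the sum diverges. -/
noncomputable def totalMass (c : CountingFunction.{u, v} Γ) (K : Type u) [Field K] [ValuativeRel K]
    [TopologicalSpace K] [IsNonarchimedeanLocalField K] : ℝ≥0∞ :=
  ∑' ρ : AbsGal K →ₜ* Γ, ((residueCard K : ℝ≥0∞) ^ c.toFun ρ)⁻¹

/-- `(Γ, c)` has a mass formula for the class `S` of local fields: there is one `f ∈ ℤ[x]` such
that `M(K, Γ, c)` is finite and equal to `f(1 / q_K)` for all `K` in `S`. -/
def HasMassFormula (c : CountingFunction.{u, v} Γ)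
    (S : ∀ (K : Type u) [Field K] [ValuativeRel K] [TopologicalSpace K]
      [IsNonarchimedeanLocalField K], Prop) : Prop :=
  ∃ f : Polynomial ℤ, ∀ (K : Type u) [Field K] [ValuativeRel K] [TopologicalSpace K]
    [IsNonarchimedeanLocalField K], S K →
    c.totalMass K ≠ ∞ ∧ (c.totalMass K).toReal = Polynomial.aeval (1 / (residueCard K : ℝ)) f

end CountingFunction

/-- `Γ` has a rational character table: all values of the characters of the irreducible
finite-dimensional complex representations of `Γ` are rational numbers. -/
def HasRationalCharacterTable (Γ : Type v) [Group Γ] : Prop :=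
  ∀ (V : Type) [AddCommGroup V] [Module ℂ V] [FiniteDimensional ℂ V] (π : Representation ℂ Γ V),
    π.IsIrreducible → ∀ g : Γ, ∃ r : ℚ, π.character g = (r : ℂ)

/-! Let `K` have residue cardinality `q` prime to `|Γ|`. A continuous homomorphism `G_K → Γ` kills
wild inertia, so it factors through the tame quotient, which is generated topologically by a
Frobenius lift `s` and a generator `t` of tame inertia with `s t s⁻¹ = t ^ q`. Homomorphisms thus
correspond to pairs `(x, y)` in `Γ × Γ` with `x y x⁻¹ = y ^ q`, and inertia has image `⟨y⟩`
(`exists_tame_equiv`). If `c` is proper, its value is a weight of `y`, and the mass is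
`tamePolynomial w q` at `1 / q`; this polynomial depends only on `q` modulo `|Γ|`
(`tamePolynomial_congr`).

The coefficient contributed by `y` is the number of `x` conjugating `y` to `y ^ q`: the order of the
centralizer of `y` if `y` and `y ^ q` are conjugate, and zero otherwise. If `y` is always conjugate
to its powers prime to `|Γ|`, the polynomial does not depend on `q`. Conversely, by Dirichlet's
theorem and the fields `ℚ_p`, a mass formula forces the polynomials of all residue classes prime to
`|Γ|` to agree, and comparing them at `1` gives this conjugacy.

That conjugacy condition is equivalent to rationality of the character table
(`hasRationalCharacterTable_iff`): the Galois automorphism `ζ ↦ ζ ^ a` takes `χ(y)` to `χ(y ^ a)`,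
and irreducible characters separate conjugacy classes. -/

open Polynomial

open scoped MonoidAlgebra

/-! ### The absolute value on the separable closure. -/

/-- The spectral norm of an algebraic extension of a complete nonarchimedean field, as an absolute
value. -/
theorem exists_spectral_absoluteValue (K L : Type*) [NontriviallyNormedField K]
    [IsUltrametricDist K] [CompleteSpace K] [Field L] [Algebra K L] [Algebra.IsAlgebraic K L] :
    ∃ w : AbsoluteValue L ℝ, IsNonarchimedean w ∧ (∀ (σ : Gal(L/K)) x, w (σ x) = w x) ∧
      (∀ x : K, w (algebraMap K L x) = ‖x‖) ∧
      ∀ x : L, w x ≤ 1 ↔ ∀ n, ‖(minpoly K x).coeff n‖ ≤ 1 := by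
  refine ⟨⟨⟨spectralNorm K L, spectralAlgNorm_mul⟩, spectralNorm_nonneg, fun x =>
    ⟨fun h => eq_zero_of_map_spectralNorm_eq_zero h (Algebra.IsAlgebraic.isAlgebraic x),
      fun h => h ▸ spectralNorm_zero⟩, map_add_le_add (spectralAlgNorm K L)⟩,
    isNonarchimedean_spectralNorm, fun σ x => (spectralNorm_eq_of_equiv σ x).symm,
    spectralNorm_extends, fun x => spectralValue_le_one_iff (minpoly.monic ?_)⟩
  exact Algebra.IsIntegral.isIntegral x

/-- Let `K` be the fraction field of the discrete valuation ring `R`, with uniformizer `π`. This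
says that `w` is an absolute value on the extension `L` of `K` that has the integral closure of `R`
as its unit ball, and is invariant under the Galois group. -/
structure IsLocalNorm (R K L : Type*) [CommRing R] [Field K] [Field L] [Algebra R K] [Algebra K L]
    [Algebra R L] (w : AbsoluteValue L ℝ) (π : K) : Prop where
  nonarch : IsNonarchimedean w
  map_gal : ∀ (σ : Gal(L/K)) x, w (σ x) = w x
  le_one_iff : ∀ x, w x ≤ 1 ↔ x ∈ integralClosure R L
  le_one_iff_base : ∀ x : K, w (algebraMap K L x) ≤ 1 ↔ ∃ r : R, algebraMap R K r = x
  unif_ne_zero : π ≠ 0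
  unif_lt_one : w (algebraMap K L π) < 1
  exists_zpow : ∀ x : K, x ≠ 0 → ∃ i : ℤ, w (algebraMap K L x) = w (algebraMap K L π) ^ i

/-- This identifies the unit ball of the spectral norm, which is defined through minimal polynomials
over `K`, with the integral closure. -/
theorem mem_integralClosure_iff_coeff_minpoly {R K L : Type*} [CommRing R] [IsDomain R]
    [Field K] [Field L] [Algebra R K] [IsFractionRing R K] [IsIntegrallyClosed R] [Algebra K L]
    [Algebra R L] [IsScalarTower R K L] [Algebra.IsAlgebraic K L] (x : L) :
    x ∈ integralClosure R L ↔ ∀ n, (minpoly K x).coeff n ∈ (algebraMap R K).range := by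
  rw [mem_integralClosure_iff]
  constructor
  · intro h n
    rw [minpoly.isIntegrallyClosed_eq_field_fractions' K h, coeff_map]
    exact ⟨_, rfl⟩
  · intro h
    have hm := minpoly.monic (Algebra.IsIntegral.isIntegral (R := K) x)
    obtain ⟨p, hp⟩ : ∃ p : R[X], p.map (algebraMap R K) = minpoly K x := by
      rw [← Polynomial.mem_lifts, Polynomial.lifts_iff_coeff_lifts]
      exact fun n => h n
    refine ⟨p, ?_, ?_⟩
    · refine monic_of_injective (IsFractionRing.injective R K) ?_
      rwa [hp]
    · have h2 := minpoly.aeval K x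
      rw [← hp, aeval_map_algebraMap] at h2
      exact h2

theorem exists_isLocalNorm (K : Type u) [Field K] [ValuativeRel K] [TopologicalSpace K]
    [IsNonarchimedeanLocalField K] : 
    ∃ w π, IsLocalNorm 𝒪[K] K (SeparableClosure K) w π := by
  let := IsTopologicalAddGroup.rightUniformSpace K
  have := isUniformAddGroup_of_addCommGroup (G := K)
  let : (Valued.v (R := K)).RankOne :=
  { hom' := ValuativeRel.IsRankLeOne.nonempty.some.emb (R := K).comp
      MonoidWithZeroHom.ValueGroup₀.embedding
    strictMono' := ValuativeRel.IsRankLeOne.nonempty.some.strictMono.comp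
        MonoidWithZeroHom.ValueGroup₀.embedding_strictMono }
  let : NontriviallyNormedField K := Valued.toNontriviallyNormedField K _
  have hul : IsUltrametricDist K := Valued.instIsUltrametricDist K _
  have hc : CompleteSpace K := inferInstance
  obtain ⟨w, h1, h2, h3, h4⟩ := exists_spectral_absoluteValue K (SeparableClosure K)
  have hn : ∀ x : K, ‖x‖ ≤ 1 ↔ x ∈ 𝒪[K] := fun x => Valued.toNormedField.norm_le_one_iff
  obtain ⟨ϖ, hϖ⟩ := IsDiscreteValuationRing.exists_irreducible 𝒪[K]
  have hb (x : K) : w (algebraMap K _ x) ≤ 1 ↔ x ∈ 𝒪[K] := by rw [h3, hn]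
  have hu (x : 𝒪[K]ˣ) : w (algebraMap K _ (x : 𝒪[K])) = 1 := by
    refine le_antisymm ((hb _).2 (x : 𝒪[K]).2) ?_
    have h5 := (hb _).2 ((x⁻¹ : 𝒪[K]ˣ) : 𝒪[K]).2
    by_contra! h6
    have h7 : w (algebraMap K (SeparableClosure K) ((x : 𝒪[K]) * ((x⁻¹ : 𝒪[K]ˣ) : 𝒪[K]) : 𝒪[K]))
        = 1 := by simp
    rw [MulMemClass.coe_mul, map_mul, map_mul] at h7
    nlinarith [w.nonneg (algebraMap K (SeparableClosure K) (x : 𝒪[K]))]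
  have hϖ0 : (ϖ : K) ≠ 0 := by simpa using hϖ.ne_zero
  have hw : ∀ x : 𝒪[K], x ≠ 0 → ∃ n : ℕ,
      w (algebraMap K (SeparableClosure K) (x : K)) = w (algebraMap K _ (ϖ : K)) ^ n := by
    intro x hx
    obtain ⟨n, e, he⟩ := IsDiscreteValuationRing.eq_unit_mul_pow_irreducible hx hϖ
    refine ⟨n, ?_⟩
    rw [he]
    rw [MulMemClass.coe_mul, map_mul, map_mul, hu, one_mul, SubmonoidClass.coe_pow, map_pow,
      map_pow]
  refine ⟨w, ϖ, h1, h2, fun x => ?_,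
    fun x => (hb x).trans ⟨fun h => ⟨⟨x, h⟩, rfl⟩, fun ⟨y, hy⟩ => hy ▸ y.2⟩, hϖ0, ?_, fun x hx => ?_⟩
  · rw [h4, mem_integralClosure_iff_coeff_minpoly (K := K)]
    refine forall_congr' fun n => ?_
    rw [hn]
    exact ⟨fun h => ⟨⟨_, h⟩, rfl⟩, fun ⟨y, hy⟩ => hy ▸ y.2⟩
  · by_contra! h
    have h5 : w (algebraMap K (SeparableClosure K) ((ϖ : K)⁻¹)) ≤ 1 := by
      rw [map_inv₀, map_inv₀]
      exact inv_le_one_of_one_le₀ h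
    rw [hb] at h5
    refine hϖ.not_isUnit (IsUnit.of_mul_eq_one ⟨_, h5⟩ ?_)
    ext
    simp [hϖ0]
  · obtain ⟨a, b, hb0, rfl⟩ := IsFractionRing.div_surjective (A := 𝒪[K]) x
    have hb' := nonZeroDivisors.ne_zero hb0
    have ha' : a ≠ 0 := by rintro rfl; simp at hx
    obtain ⟨m, hm⟩ := hw a ha'
    obtain ⟨n, hn⟩ := hw b hb'
    refine ⟨(m : ℤ) - n, ?_⟩
    have : w (algebraMap K (SeparableClosure K) (ϖ : K)) ≠ 0 := by simpa using hϖ.ne_zero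
    rw [zpow_sub₀ this, zpow_natCast, zpow_natCast, ← hm, ← hn, map_div₀, map_div₀]
    rfl

/-! ### Residue fields and the Galois action on them. -/

/-- A profinite group acting on `B` surjects onto the automorphisms of `B ⧸ Q` that fix the image
of `R`, if `R` has the same image in `B ⧸ Q` as the invariants. -/
theorem exists_smul_eq_of_profinite {R B G : Type*} [CommRing R] [CommRing B] [Algebra R B]
    [Group G] [MulSemiringAction G B] [SMulCommClass G R B] [TopologicalSpace G] [CompactSpace G]
    [TotallyDisconnectedSpace G] [IsTopologicalGroup G] [TopologicalSpace B] [DiscreteTopology B]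
    [ContinuousSMul G B] (Q : Ideal B) [Q.IsPrime]
    (hR : ∀ b : B, (∀ g : G, g • b = b) → ∃ r : R, b - algebraMap R B r ∈ Q)
    (φ : (B ⧸ Q) ≃+* (B ⧸ Q))
    (hφ : ∀ r : R, φ (Ideal.Quotient.mk Q (algebraMap R B r)) =
      Ideal.Quotient.mk Q (algebraMap R B r)) :
    ∃ g : G, ∀ b : B, Ideal.Quotient.mk Q (g • b) = φ (Ideal.Quotient.mk Q b) := by
  -- The known surjectivity concerns automorphisms over `A ⧸ P` with `A` the ring of invariants; by
  -- `hR`, `A` and `R` have the same image in `B ⧸ Q`, so `φ` is one of them.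
  let A := FixedPoints.subalgebra R B G
  have hinv : Algebra.IsInvariant A B G := ⟨fun b hb => ⟨⟨b, hb⟩, rfl⟩⟩
  have hcomm : SMulCommClass G A B := ⟨fun g a b => by
    rw [Algebra.smul_def, Algebra.smul_def, smul_mul']
    congr 1
    exact a.2 g⟩
  let P : Ideal A := Q.under A
  have hP : Q.LiesOver P := ⟨rfl⟩
  let ψ : (B ⧸ Q) ≃ₐ[A ⧸ P] (B ⧸ Q) := AlgEquiv.ofRingEquiv (f := φ) (by
    intro x
    obtain ⟨a, rfl⟩ := Ideal.Quotient.mk_surjective x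
    obtain ⟨r, hr⟩ := hR a a.2
    have : algebraMap (A ⧸ P) (B ⧸ Q) (Ideal.Quotient.mk P a) =
      Ideal.Quotient.mk Q (algebraMap R B r) := Ideal.Quotient.eq.2 hr
    rw [this, hφ])
  obtain ⟨g, hg⟩ := Ideal.Quotient.stabilizerHom_surjective_of_profinite (G := G) P Q ψ
  refine ⟨g, fun b => ?_⟩
  have := DFunLike.congr_fun hg (Ideal.Quotient.mk Q b)
  exact this

namespace IsLocalNorm

variable {R K L : Type*} [CommRing R] [Field K] [Field L] [Algebra R K] [Algebra K L]
    [Algebra R L] {w : AbsoluteValue L ℝ} {π : K} (h : IsLocalNorm R K L w π)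
include h

theorem isUnit_iff (x : integralClosure R L) : IsUnit x ↔ w x = 1 := by
  constructor
  · intro hx
    obtain ⟨y, hy⟩ := isUnit_iff_exists_inv.1 hx
    have h1 : w ((x * y : integralClosure R L) : L) = 1 := by simp [hy]
    rw [MulMemClass.coe_mul, map_mul] at h1
    have h2 := (h.le_one_iff _).2 x.2
    have h3 := (h.le_one_iff _).2 y.2
    have h4 := w.nonneg (x : L)
    nlinarith
  · intro hx
    have hx0 : (x : L) ≠ 0 := by intro h0; simp [h0] at hx
    have h1 : (x : L)⁻¹ ∈ integralClosure R L := by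
      rw [← h.le_one_iff, map_inv₀, hx, inv_one]
    exact IsUnit.of_mul_eq_one ⟨_, h1⟩ (Subtype.ext (mul_inv_cancel₀ hx0))

theorem mem_nonunits_iff (x : integralClosure R L) : x ∈ nonunits _ ↔ w x < 1 := by
  rw [_root_.mem_nonunits_iff, h.isUnit_iff, lt_iff_le_and_ne]
  simp [(h.le_one_iff _).2 x.2]

theorem add_lt {x y : L} {c : ℝ} (hx : w x < c) (hy : w y < c) : w (x + y) < c :=
  (h.nonarch x y).trans_lt (max_lt hx hy)

theorem sub_lt {x y : L} {c : ℝ} (hx : w x < c) (hy : w y < c) : w (x - y) < c := by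
  rw [sub_eq_add_neg]
  exact h.add_lt hx (by rwa [w.map_neg])

theorem isLocalRing : IsLocalRing (integralClosure R L) :=
  IsLocalRing.of_nonunits_add fun a b ha hb => by
    rw [h.mem_nonunits_iff] at *
    exact h.add_lt ha hb

theorem mem_maximalIdeal_iff [IsLocalRing (integralClosure R L)] (x : integralClosure R L) :
    x ∈ IsLocalRing.maximalIdeal (integralClosure R L) ↔ w x < 1 := by
  rw [IsLocalRing.mem_maximalIdeal, h.mem_nonunits_iff]

theorem mem_jacobson_iff (x : integralClosure R L) :
    x ∈ Ring.jacobson (integralClosure R L) ↔ w x < 1 := by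
  have := h.isLocalRing
  rw [IsLocalRing.ringJacobson_eq_maximalIdeal, h.mem_maximalIdeal_iff]

theorem mem_inertia_iff [IsScalarTower R K L] (σ : Gal(L/K)) :
    σ ∈ (Ring.jacobson (integralClosure R L)).inertia Gal(L/K) ↔
      ∀ x, w x ≤ 1 → w (σ x - x) < 1 := by
  constructor
  · intro hs x hx
    exact (h.mem_jacobson_iff _).1 (hs ⟨x, (h.le_one_iff x).1 hx⟩)
  · intro hs x
    exact (h.mem_jacobson_iff _).2 (hs _ ((h.le_one_iff _).2 x.2))

theorem algebraMap_le_one [IsScalarTower R K L] (r : R) : w (algebraMap R L r) ≤ 1 := by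
  rw [IsScalarTower.algebraMap_apply R K L, h.le_one_iff_base]
  exact ⟨r, rfl⟩

theorem isLocalHom [IsDomain R] [IsFractionRing R K] [IsScalarTower R K L] :
    IsLocalHom (algebraMap R (integralClosure R L)) := ⟨fun r hr => by
  rw [h.isUnit_iff] at hr
  have hr' : w (algebraMap R L r) = 1 := hr
  have hr0 : r ≠ 0 := by rintro rfl; simp at hr'
  have h1 : w (algebraMap K L (algebraMap R K r)⁻¹) ≤ 1 := by
    rw [map_inv₀, map_inv₀, ← IsScalarTower.algebraMap_apply, hr', inv_one]
  obtain ⟨s, hs⟩ := (h.le_one_iff_base _).1 h1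
  refine IsUnit.of_mul_eq_one s (IsFractionRing.injective R K ?_)
  rw [map_mul, hs, map_one, mul_inv_cancel₀]
  simpa using hr0⟩

theorem algebraMap_lt_one_iff [IsDomain R] [IsLocalRing R] [IsFractionRing R K]
    [IsScalarTower R K L] (r : R) :
    w (algebraMap R L r) < 1 ↔ r ∈ IsLocalRing.maximalIdeal R := by
  have h1 := h.isLocalHom
  rw [IsLocalRing.mem_maximalIdeal, _root_.mem_nonunits_iff,
    ← isUnit_map_iff (algebraMap R (integralClosure R L)), h.isUnit_iff, lt_iff_le_and_ne]
  simp only [h.algebraMap_le_one, true_and]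
  rfl

theorem natCast_lt_one_iff [IsDomain R] [IsLocalRing R] [IsFractionRing R K]
    [IsScalarTower R K L] (n : ℕ) :
    w (n : L) < 1 ↔ (n : IsLocalRing.ResidueField R) = 0 := by
  rw [← map_natCast (algebraMap R L), h.algebraMap_lt_one_iff, ← IsLocalRing.residue_eq_zero_iff,
    map_natCast]

theorem natCast_eq_one [IsDomain R] [IsLocalRing R] [IsFractionRing R K]
    [IsScalarTower R K L] {n : ℕ} (hn : (Nat.card (IsLocalRing.ResidueField R)).Coprime n) :
    w (n : L) = 1 := by
  refine le_antisymm (h.nonarch.apply_natCast_le_one) ?_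
  by_contra! h1
  rw [h.natCast_lt_one_iff] at h1
  have h2 : ((Nat.card (IsLocalRing.ResidueField R) : ℕ) : IsLocalRing.ResidueField R) = 0 := by
    -- For an infinite residue field `Nat.card` is `0`, so the claim holds there too.
    cases finite_or_infinite (IsLocalRing.ResidueField R)
    · have := Fintype.ofFinite (IsLocalRing.ResidueField R)
      rw [Nat.card_eq_fintype_card, Nat.cast_card_eq_zero]
    · simp
  -- Bézout: the gcd, which is `1`, would vanish in the residue field.
  have h3 : (((Nat.card (IsLocalRing.ResidueField R)).gcd n : ℤ) : IsLocalRing.ResidueField R)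
      = 0 := by
    rw [Nat.gcd_eq_gcd_ab]
    push_cast
    simp [h1, h2]
  rw [hn] at h3
  simp at h3

end IsLocalNorm

/-- An automorphism of an algebraic extension of a finite field acts on every finite subextension
as a power of the Frobenius. -/
theorem FiniteField.exists_pow_card_pow {k κ : Type*} [Field k] [Fintype k] [Field κ] [Algebra k κ]
    (τ : κ ≃ₐ[k] κ) (k' : IntermediateField k κ) [FiniteDimensional k k'] :
    ∃ j : ℕ, ∀ x ∈ k', τ x = x ^ Fintype.card k ^ j := by
  have : Finite k' := Module.finite_of_finite k
  obtain ⟨j, hj⟩ := (FiniteField.bijective_frobeniusAlgEquivOfAlgebraic_pow k k').2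
    (τ.restrictNormal k')
  refine ⟨j, fun x hx => ?_⟩
  have h1 := congr_arg (algebraMap k' κ) (DFunLike.congr_fun hj ⟨x, hx⟩)
  rw [AlgEquiv.restrictNormal_commutes, AlgEquiv.coe_pow,
    FiniteField.coe_frobeniusAlgEquivOfAlgebraic_iterate, map_pow] at h1
  exact h1.symm

namespace IsLocalNorm

variable {R K L : Type*} [CommRing R] [IsDomain R] [IsDiscreteValuationRing R]
    [Finite (IsLocalRing.ResidueField R)] [Field K] [Field L] [Algebra R K] [Algebra K L]
    [Algebra R L] [IsFractionRing R K] [IsScalarTower R K L] [IsGalois K L]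
    {w : AbsoluteValue L ℝ} {π : K} (h : IsLocalNorm R K L w π)
include h

/-- An automorphism of `L` acts on the residue field of a finite subextension as a power of the
Frobenius. -/
theorem exists_pow_card_pow (E : IntermediateField K L) [FiniteDimensional K E]
    (σ : Gal(L/K)) : ∃ j : ℕ, ∀ x ∈ E, w x ≤ 1 →
      w (σ x - x ^ Nat.card (IsLocalRing.ResidueField R) ^ j) < 1 := by
  classical
  have := h.isLocalRing
  have := h.isLocalHom
  have := Fintype.ofFinite (IsLocalRing.ResidueField R)
  let O := integralClosure R L
  let k := IsLocalRing.ResidueField R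
  let κ := IsLocalRing.ResidueField O
  have hint : Algebra.IsIntegral R O := inferInstance
  have hint : Algebra.IsIntegral k κ :=
    Ideal.Quotient.algebra_isIntegral_of_liesOver (IsLocalRing.maximalIdeal O)
      (IsLocalRing.maximalIdeal R)
  have : IsScalarTower R E L := IsScalarTower.of_algebraMap_eq fun r => by
    rw [IsScalarTower.algebraMap_apply R K L, IsScalarTower.algebraMap_apply R K E]
    rfl
  let C := integralClosure R E
  have hfin : Module.Finite R C := IsIntegralClosure.finite R K E C
  obtain ⟨S, hS⟩ := hfin
  let f : C →ₐ[R] O := (IsScalarTower.toAlgHom R E L).mapIntegralClosure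
  let g : C →ₐ[R] κ := (IsScalarTower.toAlgHom R O κ).comp f
  -- The integers of `E` form a finite `R`-module, so their residues lie in the finite extension
  -- `k'` of `k` generated by the residues of `S`.
  let k' : IntermediateField k κ := IntermediateField.adjoin k (S.image g : Set κ)
  have hk' : FiniteDimensional k k' := IntermediateField.finiteDimensional_adjoin
    fun x _ => Algebra.IsIntegral.isIntegral x
  have hmem : ∀ c : C, g c ∈ k' := by
    intro c
    have hc : c ∈ Submodule.span R (S : Set C) := hS ▸ Submodule.mem_top
    induction hc using Submodule.span_induction with
    | mem x hx =>
      exact IntermediateField.subset_adjoin k _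
        (Finset.mem_coe.2 (Finset.mem_image_of_mem g hx))
    | zero => simp
    | add x y _ _ hx hy => rw [map_add]; exact add_mem hx hy
    | smul r x _ hx =>
      rw [map_smul, ← algebraMap_smul k r (g x)]
      exact k'.smul_mem hx
  let τ : κ ≃ₐ[k] κ := AlgEquiv.ofRingEquiv
    (f := IsLocalRing.ResidueField.mapEquiv (MulSemiringAction.toRingEquiv Gal(L/K) O σ)) (by
      intro x
      obtain ⟨r, rfl⟩ := IsLocalRing.residue_surjective x
      rw [IsLocalRing.ResidueField.algebraMap_residue]
      change IsLocalRing.residue O (σ • algebraMap R O r) = _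
      rw [smul_algebraMap])
  obtain ⟨j, hj⟩ := FiniteField.exists_pow_card_pow τ k'
  refine ⟨j, fun x hxE hx => ?_⟩
  have hxO := (h.le_one_iff x).1 hx
  have hxC : (⟨x, hxE⟩ : E) ∈ integralClosure R E := by
    rw [mem_integralClosure_iff] at hxO ⊢
    exact (isIntegral_algHom_iff (IsScalarTower.toAlgHom R E L)
      (algebraMap E L).injective).1 hxO
  let c : C := ⟨⟨x, hxE⟩, hxC⟩
  let y : O := ⟨x, hxO⟩
  have hgc : g c = IsLocalRing.residue O y := rfl
  have h1 := hj _ (hgc ▸ hmem c)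
  have h2 : IsLocalRing.residue O (σ • y - y ^ Fintype.card k ^ (j : ℕ)) = 0 := by
    rw [map_sub, map_pow, sub_eq_zero]
    exact h1
  rw [IsLocalRing.residue_eq_zero_iff, h.mem_maximalIdeal_iff] at h2
  rw [Nat.card_eq_fintype_card]
  exact h2

end IsLocalNorm

/-! ### The totally ramified extension `K(ϖ)`, Frobenius and inertia lifts. -/

namespace IsLocalNorm

section Radical

variable {R K L : Type*} [CommRing R] [Field K] [Field L] [Algebra R K] [Algebra K L]
    [Algebra R L] {w : AbsoluteValue L ℝ} {π : K} (h : IsLocalNorm R K L w π)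
    {N : ℕ} (hN : N ≠ 0) {ϖ : L} (hϖ : ϖ ^ N = algebraMap K L π)
include h

theorem sum_lt {ι : Type*} {s : Finset ι} {f : ι → L} {c : ℝ} (hc : 0 < c)
    (hf : ∀ i ∈ s, w (f i) < c) : w (∑ i ∈ s, f i) < c :=
  Finset.sum_induction f (fun x => w x < c) (fun _ _ => h.add_lt) (by simpa using hc) hf

include hϖ

theorem root_lt_one : w ϖ < 1 := by
  have h1 := h.unif_lt_one
  rw [← hϖ, map_pow] at h1
  by_contra! h2
  exact absurd (one_le_pow₀ h2 (n := N)) (not_le.2 h1)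

theorem exists_zpow_root {a : K} (ha : a ≠ 0) :
    ∃ m : ℤ, w (algebraMap K L a) = w ϖ ^ (N * m : ℤ) := by
  obtain ⟨m, hm⟩ := h.exists_zpow a ha
  refine ⟨m, ?_⟩
  rw [hm, ← hϖ, map_pow, zpow_mul, zpow_natCast]

include hN

theorem root_ne_zero : ϖ ≠ 0 := by
  rintro rfl
  rw [zero_pow hN, eq_comm, map_eq_zero] at hϖ
  exact h.unif_ne_zero hϖ

theorem root_pos : 0 < w ϖ := w.pos (h.root_ne_zero hN hϖ)

theorem root_zpow_injective : Function.Injective fun n : ℤ => w ϖ ^ n :=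
  zpow_right_injective₀ (h.root_pos hN hϖ) (h.root_lt_one hϖ).ne

/-- Nonzero elements of `K` have values `w ϖ ^ (N * m)`, so the exponent of `w ϖ` in each term
determines `i` modulo `N`. -/
theorem norm_term_ne {a b : K} (ha : a ≠ 0) (hb : b ≠ 0) {i j : ℕ} (hi : i < N) (hj : j < N)
    (hij : i ≠ j) : w (algebraMap K L a * ϖ ^ i) ≠ w (algebraMap K L b * ϖ ^ j) := by
  obtain ⟨m, hm⟩ := h.exists_zpow_root hϖ ha
  obtain ⟨n, hn⟩ := h.exists_zpow_root hϖ hb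
  have h0 := (h.root_pos hN hϖ).ne'
  rw [map_mul, map_mul, hm, hn, map_pow, map_pow, ← zpow_natCast, ← zpow_natCast,
    ← zpow_add₀ h0, ← zpow_add₀ h0]
  intro he
  have he' := h.root_zpow_injective hN hϖ he
  apply hij
  have h3 := congr_arg (· % (N : ℤ)) he'
  simp only [Int.mul_add_emod_self_left] at h3
  rw [Int.emod_eq_of_lt (by omega) (by omega), Int.emod_eq_of_lt (by omega) (by omega)] at h3
  exact_mod_cast h3

/-- The nonzero terms have distinct values, so the value of the sum is the largest of them. -/
theorem norm_term_le_norm_aeval {P : K[X]} (hP : P.natDegree < N) (i : ℕ) :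
    w (algebraMap K L (P.coeff i) * ϖ ^ i) ≤ w (aeval ϖ P) := by
  by_cases hi : P.coeff i = 0
  · simp [hi]
  obtain ⟨k, hk, hmax⟩ := P.support.exists_max_image
    (fun i => w (algebraMap K L (P.coeff i) * ϖ ^ i)) ⟨i, mem_support_iff.2 hi⟩
  have h1 : w (aeval ϖ P) = w (algebraMap K L (P.coeff k) * ϖ ^ k) := by
    rw [aeval_def, eval₂_eq_sum, Polynomial.sum_def]
    refine h.nonarch.apply_sum_eq_of_lt (fun a => (w.map_neg a).symm) hk fun j hj hjk => ?_
    refine (hmax j hj).lt_of_ne (h.norm_term_ne hN hϖ (mem_support_iff.1 hj)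
      (mem_support_iff.1 hk) ?_ ?_ hjk)
    · exact (le_natDegree_of_mem_supp _ hj).trans_lt hP
    · exact (le_natDegree_of_mem_supp _ hk).trans_lt hP
  rw [h1]
  exact hmax i (mem_support_iff.2 hi)

theorem aeval_root_ne_zero {P : K[X]} (hP : P.natDegree < N) (hP0 : P ≠ 0) : aeval ϖ P ≠ 0 := by
  intro h0
  have h1 := h.norm_term_le_norm_aeval hN hϖ hP P.natDegree
  rw [h0, map_zero, map_mul, map_pow] at h1
  have h2 : 0 < w (algebraMap K L (P.coeff P.natDegree)) := by
    apply w.pos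
    simpa using hP0
  have h3 := h.root_pos hN hϖ
  exact absurd h1 (not_le.2 (by positivity))

theorem minpoly_root [Algebra.IsIntegral K L] : minpoly K ϖ = X ^ N - C π := by
  have hi := Algebra.IsIntegral.isIntegral (R := K) ϖ
  have h0 : aeval ϖ (X ^ N - C π) = 0 := by simp [hϖ]
  refine (eq_of_monic_of_dvd_of_natDegree_le (minpoly.monic hi) (monic_X_pow_sub_C π hN)
    (minpoly.dvd K ϖ h0) ?_).symm
  rw [natDegree_X_pow_sub_C]
  by_contra! h1
  exact h.aeval_root_ne_zero hN hϖ h1 (minpoly.ne_zero hi) (minpoly.aeval K ϖ)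

/-- The extension generated by a root of the uniformizer has no residual extension. -/
theorem exists_sub_lt_one_of_mem_adjoin_root [Algebra.IsIntegral K L] [IsScalarTower R K L] {x : L}
    (hx : x ∈ IntermediateField.adjoin K {ϖ}) (hx1 : w x ≤ 1) :
    ∃ r : R, w (x - algebraMap R L r) < 1 := by
  have hi := Algebra.IsIntegral.isIntegral (R := K) ϖ
  obtain ⟨P, rfl, hP⟩ : ∃ P : K[X], aeval ϖ P = x ∧ P.natDegree < N := by
    have hx' : x ∈ Algebra.adjoin K {ϖ} := by
      rw [← IntermediateField.adjoin_simple_toSubalgebra_of_isAlgebraic hi.isAlgebraic]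
      exact hx
    rw [Algebra.adjoin_singleton_eq_range_aeval] at hx'
    obtain ⟨P, hP⟩ := hx'
    refine ⟨P %ₘ minpoly K ϖ, ?_, ?_⟩
    · rw [← hP]
      exact aeval_modByMonic_eq_self_of_root (minpoly.aeval K ϖ)
    · have h1 := natDegree_modByMonic_lt P (minpoly.monic hi) (minpoly.ne_one K ϖ)
      rwa [h.minpoly_root hN hϖ, natDegree_X_pow_sub_C, ← h.minpoly_root hN hϖ] at h1
  have hle := fun i => (h.norm_term_le_norm_aeval hN hϖ hP i).trans hx1
  obtain ⟨r, hr⟩ := (h.le_one_iff_base (P.coeff 0)).1 (by simpa using hle 0)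
  refine ⟨r, ?_⟩
  rw [IsScalarTower.algebraMap_apply R K L, hr, aeval_eq_sum_range' hP,
    ← Nat.sub_one_add_one hN, Finset.sum_range_succ']
  simp only [pow_zero, Algebra.smul_def, mul_one, add_sub_cancel_right]
  -- Terms of positive degree have value at most `1`, but never the value of the term `1 * ϖ ^ 0`.
  refine h.sum_lt one_pos fun i hi' => ?_
  by_cases hc : P.coeff (i + 1) = 0
  · simp [hc]
  refine (hle (i + 1)).lt_of_ne ?_
  have h2 := h.norm_term_ne hN hϖ hc one_ne_zero (i := i + 1) (j := 0)
    (by have := Finset.mem_range.1 hi'; omega) (by omega) (by omega)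
  simpa using h2

end Radical

section Lift

variable {R K L : Type*} [CommRing R] [Field K] [Field L] [Algebra R K] [Algebra K L]
    [Algebra R L] [IsScalarTower R K L] [IsGalois K L]
    {w : AbsoluteValue L ℝ} {π : K} (h : IsLocalNorm R K L w π)
    {N : ℕ} (hN : N ≠ 0) {ϖ : L} (hϖ : ϖ ^ N = algebraMap K L π)
include h hN hϖ

/-- Since `K(ϖ)` has the same residue field as `K`, the closed subgroup fixing `ϖ` still surjects
onto the automorphisms of the residue field of `L` over that of `R`. -/
theorem exists_gal_fixing_root_and_lifting [IsLocalRing (integralClosure R L)]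
    (φ : IsLocalRing.ResidueField (integralClosure R L) ≃+*
      IsLocalRing.ResidueField (integralClosure R L))
    (hφ : ∀ r : R, φ (IsLocalRing.residue _ (algebraMap R (integralClosure R L) r)) =
      IsLocalRing.residue _ (algebraMap R (integralClosure R L) r)) :
    ∃ g : Gal(L/K), g ϖ = ϖ ∧ ∀ x : integralClosure R L,
      IsLocalRing.residue _ (g • x) = φ (IsLocalRing.residue _ x) := by
  let O := integralClosure R L
  let H := (IntermediateField.adjoin K {ϖ}).fixingSubgroup
  let : TopologicalSpace O := ⊥
  have : DiscreteTopology O := ⟨rfl⟩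
  have : CompactSpace H := isCompact_iff_compactSpace.1
    (InfiniteGalois.fixingSubgroup_isClosed _).isCompact
  have : ContinuousSMul H O := by
    rw [continuousSMul_iff_stabilizer_isOpen]
    intro x
    convert (stabilizer_isOpen_of_isIntegral (K := K) (x : L)).preimage
      (continuous_subtype_val (p := (· ∈ H)))
    ext g
    simp only [SetLike.mem_coe, MulAction.mem_stabilizer_iff, Set.mem_preimage, Subtype.ext_iff]
    rfl
  obtain ⟨g, hg⟩ := exists_smul_eq_of_profinite (R := R) (B := O) (G := H)
    (IsLocalRing.maximalIdeal O) (by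
      intro b hb
      have hb' : (b : L) ∈ IntermediateField.adjoin K {ϖ} := by
        rw [← InfiniteGalois.fixedField_fixingSubgroup (IntermediateField.adjoin K {ϖ})]
        exact fun g => congr_arg Subtype.val (hb g)
      obtain ⟨r, hr⟩ := h.exists_sub_lt_one_of_mem_adjoin_root hN hϖ hb' ((h.le_one_iff _).2 b.2)
      exact ⟨r, (h.mem_maximalIdeal_iff _).2 hr⟩) φ hφ
  exact ⟨g, g.2 ⟨ϖ, IntermediateField.mem_adjoin_simple_self K ϖ⟩, hg⟩

/-- There is an element of inertia that multiplies a given root of the uniformizer by a given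
root of unity. -/
theorem exists_inertia_mul_root {ξ : L} (hξ : ξ ^ N = 1) :
    ∃ t : Gal(L/K), t ϖ = ξ * ϖ ∧ ∀ x, w x ≤ 1 → w (t x - x) < 1 := by
  have := h.isLocalRing
  let O := integralClosure R L
  obtain ⟨σ, hσ⟩ : ∃ σ : Gal(L/K), σ ϖ = ξ * ϖ := by
    rw [← isConjRoot_iff_exists_algEquiv]
    have hξϖ : (ξ * ϖ) ^ N = algebraMap K L π := by rw [mul_pow, hξ, one_mul, hϖ]
    rw [isConjRoot_def, h.minpoly_root hN hϖ, h.minpoly_root hN hξϖ]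
  -- `σ` has the right effect on `ϖ` but may act on residues; `g` has the same residue action and
  -- fixes `ϖ`, so `σ * g⁻¹` is in inertia.
  obtain ⟨g, hg, hg'⟩ := h.exists_gal_fixing_root_and_lifting hN hϖ
    (IsLocalRing.ResidueField.mapEquiv (MulSemiringAction.toRingEquiv Gal(L/K) O σ)) (by
      intro r
      change IsLocalRing.residue O (σ • algebraMap R O r) = _
      rw [smul_algebraMap])
  refine ⟨σ * g⁻¹, ?_, fun x hx => ?_⟩
  · rw [AlgEquiv.mul_apply, show g⁻¹ ϖ = ϖ from (AlgEquiv.symm_apply_eq g).2 hg.symm, hσ]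
  · obtain ⟨z, rfl⟩ := g.surjective x
    rw [AlgEquiv.mul_apply, show g⁻¹ (g z) = z from g.symm_apply_apply z]
    rw [h.map_gal] at hx
    let y : O := ⟨z, (h.le_one_iff z).1 hx⟩
    have h1 : IsLocalRing.residue O (g • y) = IsLocalRing.residue O (σ • y) := hg' y
    rw [eq_comm, ← sub_eq_zero, ← map_sub, IsLocalRing.residue_eq_zero_iff,
      h.mem_maximalIdeal_iff] at h1
    exact h1

variable [IsDomain R] [IsLocalRing R] [IsFractionRing R K]

/-- There is a lift of the Frobenius that fixes a given root of the uniformizer. -/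
theorem exists_frobenius_fixing_root [Finite (IsLocalRing.ResidueField R)] :
    ∃ s : Gal(L/K), s ϖ = ϖ ∧
      ∀ x, w x ≤ 1 → w (s x - x ^ Nat.card (IsLocalRing.ResidueField R)) < 1 := by
  have := h.isLocalRing
  have := h.isLocalHom
  have := Fintype.ofFinite (IsLocalRing.ResidueField R)
  let O := integralClosure R L
  let k := IsLocalRing.ResidueField R
  let κ := IsLocalRing.ResidueField O
  have hint : Algebra.IsIntegral R O := inferInstance
  have hint : Algebra.IsIntegral k κ :=
    Ideal.Quotient.algebra_isIntegral_of_liesOver (IsLocalRing.maximalIdeal O)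
      (IsLocalRing.maximalIdeal R)
  obtain ⟨s, hs, hs'⟩ := h.exists_gal_fixing_root_and_lifting hN hϖ
    (FiniteField.frobeniusAlgEquivOfAlgebraic k κ).toRingEquiv
    (fun r => (FiniteField.frobeniusAlgEquivOfAlgebraic k κ).commutes (IsLocalRing.residue R r))
  refine ⟨s, hs, fun x hx => ?_⟩
  let y : O := ⟨x, (h.le_one_iff x).1 hx⟩
  have h1 : IsLocalRing.residue O (s • y) = (IsLocalRing.residue O y) ^ Fintype.card k := hs' y
  rw [← map_pow, ← sub_eq_zero, ← map_sub, IsLocalRing.residue_eq_zero_iff,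
    h.mem_maximalIdeal_iff] at h1
  rw [Nat.card_eq_fintype_card]
  exact h1

end Lift

end IsLocalNorm

theorem AbsoluteValue.eq_one_of_pow_eq_one {L : Type*} [Field L] (w : AbsoluteValue L ℝ) {N : ℕ}
    (hN : N ≠ 0) {ζ : L} (hζ : ζ ^ N = 1) : w ζ = 1 := by
  rw [← pow_eq_one_iff_of_nonneg (w.nonneg ζ) hN, ← map_pow, hζ, map_one]

namespace IsLocalNorm

/-! ### Wild inertia dies in a group of order prime to the residue characteristic. -/

section Wild

variable {R K L : Type*} [CommRing R] [Field K] [Field L] [Algebra R K] [Algebra K L]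
    [Algebra R L] {w : AbsoluteValue L ℝ} {π : K} (h : IsLocalNorm R K L w π) {N : ℕ}
include h

/-- Roots of unity of order prime to the residue characteristic are determined by their residue
classes. -/
theorem eq_of_pow_eq_one (hN : w (N : L) = 1) {a b : L} (ha : a ^ N = 1) (hb : b ^ N = 1)
    (hab : w (a - b) < 1) : a = b := by
  have hN0 : N ≠ 0 := by rintro rfl; simp at hN
  have hb0 : b ≠ 0 := by rintro rfl; simp [hN0] at hb
  have hwb : w b = 1 := w.eq_one_of_pow_eq_one hN0 hb
  by_contra hne
  set c := a / b with hc
  have hc1 : c ≠ 1 := by rwa [hc, ne_eq, div_eq_one_iff_eq hb0]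
  have hcN : c ^ N = 1 := by rw [hc, div_pow, ha, hb, div_one]
  have hcw : w (c - 1) < 1 := by
    rw [hc, div_sub_one hb0, map_div₀, hwb, div_one]
    exact hab
  have hwc : w c = 1 := w.eq_one_of_pow_eq_one hN0 hcN
  have hci : ∀ i : ℕ, w (c ^ i - 1) < 1 := by
    intro i
    induction i with
    | zero => simp
    | succ i ih =>
      rw [show c ^ (i + 1) - 1 = c * (c ^ i - 1) + (c - 1) by ring]
      exact h.add_lt (by rwa [map_mul, hwc, one_mul]) hcw
  -- As `c ≠ 1` is an `N`-th root of unity, its geometric sum vanishes; but each `c ^ i - 1` is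
  -- small while `N` is a unit.
  have h1 : ∑ i ∈ Finset.range N, (c ^ i - 1) = -(N : L) := by
    have h2 := mul_geom_sum c N
    rw [hcN, sub_self, mul_eq_zero, or_iff_right (sub_ne_zero.2 hc1)] at h2
    simp [h2]
  have h2 := h.sum_lt one_pos (s := Finset.range N) (f := fun i => c ^ i - 1) fun i _ => hci i
  rw [h1, w.map_neg, hN] at h2
  exact lt_irrefl _ h2

variable [IsGalois K L] {Γ : Type*} [Group Γ] [Finite Γ] (ρ : Gal(L/K) →* Γ)

/-- The values of `w` on the fixed field of `ρ`. -/
theorem exists_zpow_of_fixed (hN : N ≠ 0) (hΓ : Nat.card Γ ∣ N) {ϖ : L}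
    (hϖ : ϖ ^ N = algebraMap K L π) {x : L} (hx : ∀ g ∈ ρ.ker, g x = x) (hx0 : x ≠ 0) :
    ∃ i : ℤ, w x = w ϖ ^ i := by
  classical
  have hfin : Finite (Gal(L/K) ⧸ ρ.ker) :=
    Finite.of_equiv _ (QuotientGroup.quotientKerEquivRange ρ).symm.toEquiv
  have := Fintype.ofFinite (Gal(L/K) ⧸ ρ.ker)
  -- The product of the conjugates of `x` over this quotient lies in `K`; its value is a power of `w
  -- ϖ ^ N`, and also `w x` to a power dividing `N`.
  let f : Gal(L/K) ⧸ ρ.ker → L := fun c => Quotient.liftOn' c (fun g => g x) (by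
    intro a b hab
    rw [QuotientGroup.leftRel_apply] at hab
    have h1 := congr_arg a (hx _ hab)
    rw [AlgEquiv.mul_apply] at h1
    change a x = b x
    rw [← h1]
    exact (a.apply_symm_apply (b x)))
  have hf : ∀ (g : Gal(L/K)) c, g (f c) = f (g • c) := fun g c => Quotient.inductionOn' c fun _ => rfl
  have hwf : ∀ c, w (f c) = w x := fun c => Quotient.inductionOn' c fun g => h.map_gal g x
  obtain ⟨a, ha⟩ := (InfiniteGalois.mem_range_algebraMap_iff_fixed (k := K) (∏ c, f c)).2 (by
    intro g
    rw [map_prod]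
    simp_rw [hf]
    exact Equiv.prod_comp (MulAction.toPerm g) f)
  have hw : w (algebraMap K L a) = w x ^ Nat.card (Gal(L/K) ⧸ ρ.ker) := by
    rw [ha, map_prod]
    simp [hwf]
  obtain ⟨e, he⟩ : Nat.card (Gal(L/K) ⧸ ρ.ker) ∣ N := by
    rw [Nat.card_congr (QuotientGroup.quotientKerEquivRange ρ).toEquiv]
    exact (Subgroup.card_subgroup_dvd_card _).trans hΓ
  have ha0 : a ≠ 0 := by
    rintro rfl
    rw [map_zero, map_zero] at hw
    exact (pow_ne_zero _ (w.ne_zero hx0)) hw.symm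
  obtain ⟨m, hm⟩ := h.exists_zpow_root hϖ ha0
  refine ⟨m * e, ?_⟩
  refine (pow_left_inj₀ (w.nonneg x) (zpow_nonneg (w.nonneg ϖ) _) hN).1 ?_
  rw [← zpow_natCast (w ϖ ^ _), ← zpow_mul]
  nth_rw 1 [he]
  rw [pow_mul, ← hw, hm, ← zpow_natCast, ← zpow_mul]
  congr 1
  ring

/-- A homomorphism to a finite group of order prime to the residue characteristic is trivial on
the elements that fix a suitable root of the uniformizer and act trivially on residues. -/
theorem map_eq_one_of_fixes_root (hN : w (N : L) = 1) (hΓ : Nat.card Γ ∣ N) {ϖ : L}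
    (hϖ : ϖ ^ N = algebraMap K L π) (hρ : IsClosed (ρ.ker : Set Gal(L/K)))
    {E : IntermediateField K L} (hE : E.fixingSubgroup ≤ ρ.ker) (hϖE : ϖ ∈ E) {σ : Gal(L/K)}
    (hσ : σ ϖ = ϖ) (hσE : ∀ x ∈ E, w x ≤ 1 → w (σ x - x) < 1) : ρ σ = 1 := by
  have hN0 : N ≠ 0 := by rintro rfl; simp at hN
  have hϖ0 := h.root_ne_zero hN0 hϖ
  let F := IntermediateField.fixedField ρ.ker
  have hF : ∀ {x}, x ∈ F ↔ ∀ g ∈ ρ.ker, g x = x := fun {x} =>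
    IntermediateField.mem_fixedField_iff _ _
  have hFE : F ≤ E := by
    rw [← InfiniteGalois.fixedField_fixingSubgroup E]
    exact IntermediateField.fixedField_le hE
  have hFσ : ∀ x ∈ F, σ x ∈ F := by
    intro x hx
    rw [hF] at hx ⊢
    intro g hg
    have h1 := congr_arg σ (hx (σ⁻¹ * g * σ) (by
      simpa using Subgroup.Normal.conj_mem inferInstance g hg σ⁻¹))
    rw [AlgEquiv.mul_apply, AlgEquiv.mul_apply] at h1
    exact (σ.apply_symm_apply _).symm.trans h1
  -- Dividing by a power of `ϖ`, which `σ` fixes, reduces to units of `E`, where the hypothesis on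
  -- residues applies.
  have key : ∀ x ∈ F, x ≠ 0 → w (σ x - x) < w x := by
    intro x hx hx0
    obtain ⟨i, hi⟩ := h.exists_zpow_of_fixed ρ hN0 hΓ hϖ (hF.1 hx) hx0
    have hyE : x / ϖ ^ i ∈ E := div_mem (hFE hx) (zpow_mem hϖE i)
    have hy : w (x / ϖ ^ i) = 1 := by
      rw [map_div₀, map_zpow₀, ← hi, div_self (w.ne_zero hx0)]
    have h1 := hσE _ hyE hy.le
    rw [map_div₀, map_zpow₀, hσ, ← sub_div, map_div₀, map_zpow₀, ← hi,
      div_lt_one (w.pos hx0)] at h1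
    exact h1
  have hfix : ∀ x ∈ F, σ x = x := by
    intro x hx
    by_contra hne
    set u := σ x - x with hu
    have hu0 : u ≠ 0 := sub_ne_zero.2 hne
    have huF : u ∈ F := sub_mem (hFσ x hx) hx
    have hui : ∀ i : ℕ, w ((σ ^ i) u - u) < w u := by
      intro i
      induction i with
      | zero => simpa using w.pos hu0
      | succ i ih =>
        rw [pow_succ', AlgEquiv.mul_apply,
          show σ ((σ ^ i) u) - u = σ ((σ ^ i) u - u) + (σ u - u) by
            rw [map_sub σ ((σ ^ i) u) u]; ring]
        exact h.add_lt (by rwa [h.map_gal]) (key u huF hu0)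
    -- The sum telescopes to `σ ^ N x - x`, and `σ ^ N` is in the kernel. Since each `(σ ^ i) u` is
    -- close to `u`, the sum is also close to `N * u`, whose value is `w u`: a contradiction.
    have h1 : ∑ i ∈ Finset.range N, (σ ^ i) u = 0 := by
      have h2 : ∀ i : ℕ, (σ ^ i) u = (σ ^ (i + 1)) x - (σ ^ i) x := by
        intro i
        rw [hu, map_sub, pow_succ, AlgEquiv.mul_apply]
      simp_rw [h2]
      rw [Finset.sum_range_sub (fun i => (σ ^ i) x), pow_zero, AlgEquiv.one_apply,
        hF.1 hx (σ ^ N) ?_, sub_self]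
      obtain ⟨e, rfl⟩ := hΓ
      rw [MonoidHom.mem_ker, map_pow, pow_mul, pow_card_eq_one', one_pow]
    have h2 : ∑ i ∈ Finset.range N, ((σ ^ i) u - u) = -(N * u) := by
      rw [Finset.sum_sub_distrib, h1]
      simp
    have h3 := h.sum_lt (w.pos hu0) (s := Finset.range N) (f := fun i => (σ ^ i) u - u)
      fun i _ => hui i
    rw [h2, w.map_neg, map_mul, hN, one_mul] at h3
    exact lt_irrefl _ h3
  have h1 : σ ∈ F.fixingSubgroup := (IntermediateField.mem_fixingSubgroup_iff _ _).2 hfix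
  have h2 := InfiniteGalois.fixingSubgroup_fixedField (⟨ρ.ker, hρ⟩ : ClosedSubgroup Gal(L/K))
  exact h2.le h1

end Wild

/-! ### Generators of the tame quotient. -/

/-- `s` lifts the Frobenius and fixes `ϖ`, while `t` is in the inertia group and multiplies `ϖ`
by `ξ`. -/
structure IsTamePair {K L : Type*} [Field K] [Field L] [Algebra K L] (w : AbsoluteValue L ℝ)
    (q : ℕ) (ϖ ξ : L) (s t : Gal(L/K)) : Prop where
  frob_root : s ϖ = ϖ
  frob_sub : ∀ x, w x ≤ 1 → w (s x - x ^ q) < 1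
  inertia_root : t ϖ = ξ * ϖ
  inertia_sub : ∀ x, w x ≤ 1 → w (t x - x) < 1

section TamePair

variable {R K L : Type*} [CommRing R] [Field K] [Field L] [Algebra R K] [Algebra K L]
    [Algebra R L] {w : AbsoluteValue L ℝ} {π : K} (h : IsLocalNorm R K L w π) {N : ℕ}
    (hN : w (N : L) = 1) {ϖ ξ : L} (hϖ : ϖ ^ N = algebraMap K L π) (hξ : IsPrimitiveRoot ξ N)
    {q : ℕ} {s t : Gal(L/K)} (hst : IsTamePair w q ϖ ξ s t)
include h

theorem sub_lt_mul {σ τ : Gal(L/K)} (hσ : ∀ x, w x ≤ 1 → w (σ x - x) < 1)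
    (hτ : ∀ x, w x ≤ 1 → w (τ x - x) < 1) (x : L) (hx : w x ≤ 1) : w ((σ * τ) x - x) < 1 := by
  rw [AlgEquiv.mul_apply, ← sub_add_sub_cancel _ (τ x)]
  exact h.add_lt (hσ _ (by rwa [h.map_gal])) (hτ x hx)

theorem sub_lt_inv {σ : Gal(L/K)} (hσ : ∀ x, w x ≤ 1 → w (σ x - x) < 1) (x : L) (hx : w x ≤ 1) :
    w (σ⁻¹ x - x) < 1 := by
  rw [← h.map_gal σ, map_sub, show σ (σ⁻¹ x) = x from σ.apply_symm_apply x, w.map_sub]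
  exact hσ x hx

theorem sub_lt_pow {σ : Gal(L/K)} (hσ : ∀ x, w x ≤ 1 → w (σ x - x) < 1) (n : ℕ) (x : L)
    (hx : w x ≤ 1) : w ((σ ^ n) x - x) < 1 := by
  induction n generalizing x with
  | zero => simp
  | succ n ih => rw [pow_succ]; exact h.sub_lt_mul ih hσ x hx

theorem sub_lt_conj {σ : Gal(L/K)} (hσ : ∀ x, w x ≤ 1 → w (σ x - x) < 1) (τ : Gal(L/K)) (x : L)
    (hx : w x ≤ 1) : w ((τ * σ * τ⁻¹) x - x) < 1 := by
  obtain ⟨y, rfl⟩ := τ.surjective x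
  rw [h.map_gal] at hx
  rw [AlgEquiv.mul_apply, AlgEquiv.mul_apply, show τ⁻¹ (τ y) = y from τ.symm_apply_apply y,
    ← map_sub, h.map_gal]
  exact hσ y hx

include hN hξ hϖ in
theorem exists_pow_root (σ : Gal(L/K)) : ∃ i : ℕ, σ ϖ = ξ ^ i * ϖ := by
  have hN0 : N ≠ 0 := by rintro rfl; simp at hN
  have : NeZero N := ⟨hN0⟩
  have hϖ0 := h.root_ne_zero hN0 hϖ
  obtain ⟨i, -, hi⟩ := hξ.eq_pow_of_pow_eq_one (ξ := σ ϖ / ϖ) (by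
    rw [div_pow, ← map_pow, hϖ, AlgEquiv.commutes, div_self]
    rw [← hϖ]
    exact pow_ne_zero _ hϖ0)
  exact ⟨i, by rw [hi, div_mul_cancel₀ _ hϖ0]⟩

include hst

theorem frob_pow_sub (j : ℕ) (x : L) (hx : w x ≤ 1) : w ((s ^ j) x - x ^ q ^ j) < 1 := by
  induction j generalizing x with
  | zero => simp
  | succ j ih =>
    rw [pow_succ, AlgEquiv.mul_apply, pow_succ', pow_mul,
      ← sub_add_sub_cancel _ ((s ^ j) (x ^ q)), ← map_sub]
    refine h.add_lt ?_ (ih _ ?_)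
    · rw [h.map_gal]
      exact hst.frob_sub x hx
    · rw [map_pow]
      exact pow_le_one₀ (w.nonneg x) hx

include hN in
theorem frob_pow_apply {ζ : L} (hζ : ζ ^ N = 1) (j : ℕ) : (s ^ j) ζ = ζ ^ q ^ j := by
  refine h.eq_of_pow_eq_one hN ?_ ?_
    (h.frob_pow_sub hst j ζ (w.eq_one_of_pow_eq_one (by rintro rfl; simp at hN) hζ).le)
  · rw [← map_pow, hζ, map_one]
  · rw [← pow_mul, mul_comm, pow_mul, hζ, one_pow]

include hN in
theorem inertia_apply {ζ : L} (hζ : ζ ^ N = 1) : t ζ = ζ := by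
  refine h.eq_of_pow_eq_one hN ?_ hζ
    (hst.inertia_sub ζ (w.eq_one_of_pow_eq_one (by rintro rfl; simp at hN) hζ).le)
  rw [← map_pow, hζ, map_one]

include hN hξ in
theorem inertia_pow_root (i : ℕ) : (t ^ i) ϖ = ξ ^ i * ϖ := by
  induction i with
  | zero => simp
  | succ i ih =>
    rw [pow_succ', AlgEquiv.mul_apply, ih, map_mul, map_pow,
      h.inertia_apply hN hst hξ.pow_eq_one, hst.inertia_root]
    ring

include hN hξ hϖ

variable [IsDomain R] [IsDiscreteValuationRing R] [Finite (IsLocalRing.ResidueField R)]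
    [IsFractionRing R K] [IsScalarTower R K L] [IsGalois K L]

/-- The exponent `j` is chosen to match `σ` on residues of `E`, then `i` to match it on `ϖ`. The
quotient satisfies the hypotheses under which a homomorphism to `Γ` is trivial, so `s` and `t`
generate the image. -/
theorem exists_pow_mul_pow (hq : q = Nat.card (IsLocalRing.ResidueField R))
    (E : IntermediateField K L) [FiniteDimensional K E] (σ : Gal(L/K)) :
    ∃ i j : ℕ, ((s ^ j * t ^ i)⁻¹ * σ) ϖ = ϖ ∧
      ∀ x ∈ E, w x ≤ 1 → w (((s ^ j * t ^ i)⁻¹ * σ) x - x) < 1 := by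
  obtain ⟨j, hj⟩ := h.exists_pow_card_pow E σ
  obtain ⟨i, hi⟩ := h.exists_pow_root hN hϖ hξ ((s ^ j)⁻¹ * σ)
  refine ⟨i, j, ?_, fun x hxE hx => ?_⟩
  · rw [mul_inv_rev, mul_assoc, AlgEquiv.mul_apply, hi, ← h.inertia_pow_root hN hξ hst]
    exact (t ^ i).symm_apply_apply ϖ
  · have h1 : w (((s ^ j)⁻¹ * σ) x - x) < 1 := by
      rw [← h.map_gal (s ^ j), map_sub, AlgEquiv.mul_apply,
        show (s ^ j) ((s ^ j)⁻¹ (σ x)) = σ x from (s ^ j).apply_symm_apply _,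
        ← sub_sub_sub_cancel_right _ _ (x ^ q ^ j)]
      refine h.sub_lt ?_ (h.frob_pow_sub hst j x hx)
      rw [hq]
      exact hj x hxE hx
    rw [mul_inv_rev, mul_assoc, AlgEquiv.mul_apply, ← sub_add_sub_cancel _ (((s ^ j)⁻¹ * σ) x)]
    refine h.add_lt ?_ h1
    exact h.sub_lt_inv (h.sub_lt_pow hst.inertia_sub i) _ (by rwa [h.map_gal])

/-- These exponents are used to define homomorphisms. The action on `ξ` only determines `q ^ j`
modulo `N`; a further root of unity `ζ` of order `q ^ N - 1` will determine `j` modulo `N`. -/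
theorem exists_pow_apply (hq : q = Nat.card (IsLocalRing.ResidueField R)) {M : ℕ} (hM : w (M : L) = 1) {ζ : L} (hζ : ζ ^ M = 1) (σ : Gal(L/K)) :
    ∃ i j : ℕ, σ ϖ = ξ ^ i * ϖ ∧ σ ξ = ξ ^ q ^ j ∧ σ ζ = ζ ^ q ^ j := by
  have hi : ∀ x : L, FiniteDimensional K (IntermediateField.adjoin K {x}) := fun x =>
    IntermediateField.adjoin.finiteDimensional (Algebra.IsIntegral.isIntegral x)
  let E := IntermediateField.adjoin K {ξ} ⊔ IntermediateField.adjoin K {ζ}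
  have hE : FiniteDimensional K E := IntermediateField.finiteDimensional_sup _ _
  obtain ⟨i, j, -, hσE⟩ := h.exists_pow_mul_pow hN hϖ hξ hst hq E σ
  obtain ⟨i', hi'⟩ := h.exists_pow_root hN hϖ hξ σ
  have key : ∀ {n : ℕ}, w (n : L) = 1 → ∀ {z : L}, z ∈ E → z ^ n = 1 → σ z = z ^ q ^ j := by
    intro n hn z hzE hz
    have hn0 : n ≠ 0 := by rintro rfl; simp at hn
    have h1 := h.eq_of_pow_eq_one hn (by rw [← map_pow, hz, map_one]) hz
      (hσE z hzE (w.eq_one_of_pow_eq_one hn0 hz).le)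
    rw [AlgEquiv.mul_apply] at h1
    have h2 : ∀ i : ℕ, (t ^ i) z = z := by
      intro i
      induction i with
      | zero => rfl
      | succ i ih => rw [pow_succ, AlgEquiv.mul_apply, h.inertia_apply hn hst hz, ih]
    rw [← h.frob_pow_apply hn hst hz, ← congr_arg (s ^ j) (h2 i), ← AlgEquiv.mul_apply]
    exact ((s ^ j * t ^ i).symm_apply_eq).1 h1
  exact ⟨i', j, hi', key hN ((le_sup_left : _ ≤ E) (IntermediateField.mem_adjoin_simple_self K ξ))
    hξ.pow_eq_one, key hM ((le_sup_right : _ ≤ E) (IntermediateField.mem_adjoin_simple_self K ζ)) hζ⟩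

end TamePair

end IsLocalNorm

/-- Modulo `q ^ N - 1` the powers of `q` have period `N`, and two of `1, q, …, q ^ (N - 1)` differ
by less than the modulus. -/
theorem Nat.modEq_of_pow_modEq_pow_sub_one {q N j j' : ℕ} (hq : 2 ≤ q) (hN : N ≠ 0)
    (hj : q ^ j ≡ q ^ j' [MOD q ^ N - 1]) : j ≡ j' [MOD N] := by
  have hN1 : q ^ N = q ^ (N - 1) * q := by rw [← pow_succ, Nat.sub_one_add_one hN]
  have hpos : 0 < q ^ (N - 1) := by positivity
  have h1 : q ^ N ≡ 1 [MOD q ^ N - 1] := by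
    have h2 : 1 ≤ q ^ N := Nat.one_le_pow _ _ (by omega)
    exact ((Nat.modEq_iff_dvd' h2).2 dvd_rfl).symm
  have h2 : ∀ j, q ^ j ≡ q ^ (j % N) [MOD q ^ N - 1] := by
    intro j
    conv_lhs => rw [← Nat.div_add_mod j N, pow_add, pow_mul]
    simpa using (h1.pow (j / N)).mul_right (q ^ (j % N))
  have h3 : q ^ (j % N) ≡ q ^ (j' % N) [MOD q ^ N - 1] := (h2 j).symm.trans (hj.trans (h2 j'))
  have h4 : ∀ j, 1 ≤ q ^ (j % N) ∧ q ^ (j % N) ≤ q ^ (N - 1) := fun j =>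
    ⟨Nat.one_le_pow _ _ (by omega), Nat.pow_le_pow_right (by omega)
      (by have := Nat.mod_lt j (Nat.pos_of_ne_zero hN); omega)⟩
  have h5 : q ^ (N - 1) * 2 ≤ q ^ N := by rw [hN1]; gcongr
  have h6 : q ^ (j % N) = q ^ (j' % N) := by
    have ha := h4 j
    have hb := h4 j'
    rcases le_total (q ^ (j % N)) (q ^ (j' % N)) with hle | hle
    · have := Nat.eq_zero_of_dvd_of_lt ((Nat.modEq_iff_dvd' hle).1 h3) (by omega)
      omega
    · have := Nat.eq_zero_of_dvd_of_lt ((Nat.modEq_iff_dvd' hle).1 h3.symm) (by omega)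
      omega
  exact Nat.pow_right_injective hq h6

theorem IsPrimitiveRoot.modEq_of_pow_eq {M : Type*} [CommMonoid M] {ξ : M} {N : ℕ}
    (hξ : IsPrimitiveRoot ξ N) (hN : N ≠ 0) {i j : ℕ} (hij : ξ ^ i = ξ ^ j) : i ≡ j [MOD N] := by
  obtain ⟨u, rfl⟩ := hξ.isUnit hN
  rw [IsPrimitiveRoot.coe_units_iff] at hξ
  rw [hξ.eq_orderOf, ← pow_eq_pow_iff_modEq]
  exact Units.ext (by simpa using hij)

theorem conj_pow_eq_pow {Γ : Type*} [Group Γ] {q : ℕ} {x y : Γ} (hxy : x * y * x⁻¹ = y ^ q)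
    (i j : ℕ) : x ^ j * y ^ i * (x ^ j)⁻¹ = y ^ (q ^ j * i) := by
  induction j generalizing i with
  | zero => simp
  | succ j ih =>
    rw [pow_succ, mul_inv_rev,
      show x ^ j * x * y ^ i * (x⁻¹ * (x ^ j)⁻¹) = x ^ j * (x * y ^ i * x⁻¹) * (x ^ j)⁻¹ by group,
      ← conj_pow, hxy, ← pow_mul, ih, pow_succ, mul_assoc]

/-! ### Homomorphisms to `Γ` as solutions of the tame relation. -/

namespace IsLocalNorm

variable {R K L : Type*} [CommRing R] [Field K] [Field L] [Algebra R K] [Algebra K L]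
    [Algebra R L] {w : AbsoluteValue L ℝ} {π : K} (h : IsLocalNorm R K L w π)
    {Γ : Type*} [Group Γ] [Finite Γ] [TopologicalSpace Γ] [DiscreteTopology Γ]
    (hN : w (Nat.card Γ : L) = 1) {ϖ ξ : L} (hϖ : ϖ ^ Nat.card Γ = algebraMap K L π)
    (hξ : IsPrimitiveRoot ξ (Nat.card Γ)) {q : ℕ} {s t : Gal(L/K)}
    (hst : IsTamePair w q ϖ ξ s t) [IsGalois K L]
include h hN hϖ

/-- Two homomorphisms share one `E`, so that they can be compared in `tame_hom_ext`. -/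
theorem exists_intermediateField_map_eq_one (ρ ρ' : Gal(L/K) →ₜ* Γ) :
    ∃ E : IntermediateField K L, FiniteDimensional K E ∧ ∀ σ : Gal(L/K), σ ϖ = ϖ →
      (∀ x ∈ E, w x ≤ 1 → w (σ x - x) < 1) → ρ σ = 1 ∧ ρ' σ = 1 := by
  have hopen : ∀ ρ : Gal(L/K) →ₜ* Γ, IsOpen (ρ.toMonoidHom.ker : Set Gal(L/K)) := fun ρ =>
    (isOpen_discrete {1}).preimage ρ.continuous_toFun
  have hclosed : ∀ ρ : Gal(L/K) →ₜ* Γ, IsClosed (ρ.toMonoidHom.ker : Set Gal(L/K)) := fun ρ =>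
    (isClosed_discrete {1}).preimage ρ.continuous_toFun
  obtain ⟨E, hE, hEs⟩ := (krullTopology_mem_nhds_one_iff K L _).1
    (((hopen ρ).inter (hopen ρ')).mem_nhds ⟨one_mem _, one_mem _⟩)
  have : FiniteDimensional K (IntermediateField.adjoin K {ϖ}) :=
    IntermediateField.adjoin.finiteDimensional (Algebra.IsIntegral.isIntegral ϖ)
  refine ⟨E ⊔ IntermediateField.adjoin K {ϖ}, IntermediateField.finiteDimensional_sup _ _,
    fun σ hσ hσE => ?_⟩
  have hle := IntermediateField.fixingSubgroup_antitone
    (le_sup_left : E ≤ E ⊔ IntermediateField.adjoin K {ϖ})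
  have hmem : ϖ ∈ E ⊔ IntermediateField.adjoin K {ϖ} :=
    (le_sup_right : _ ≤ E ⊔ IntermediateField.adjoin K {ϖ})
      (IntermediateField.mem_adjoin_simple_self K ϖ)
  exact ⟨h.map_eq_one_of_fixes_root ρ.toMonoidHom hN dvd_rfl hϖ (hclosed ρ)
      (fun g hg => (hEs (hle hg)).1) hmem hσ hσE,
    h.map_eq_one_of_fixes_root ρ'.toMonoidHom hN dvd_rfl hϖ (hclosed ρ')
      (fun g hg => (hEs (hle hg)).2) hmem hσ hσE⟩

include hξ hst

/-- The tame relation. -/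
theorem map_frob_conj (ρ : Gal(L/K) →ₜ* Γ) : ρ s * ρ t * (ρ s)⁻¹ = ρ t ^ q := by
  obtain ⟨E, -, hE⟩ := h.exists_intermediateField_map_eq_one hN hϖ ρ ρ
  -- This element is in inertia, and it fixes `ϖ` because `s ξ = ξ ^ q`.
  have h1 := (hE ((t ^ q)⁻¹ * (s * t * s⁻¹)) ?_ ?_).1
  · rw [map_mul, map_inv, inv_mul_eq_one] at h1
    simpa using h1.symm
  · rw [AlgEquiv.mul_apply, AlgEquiv.mul_apply, AlgEquiv.mul_apply,
      show s⁻¹ ϖ = ϖ from (AlgEquiv.symm_apply_eq s).2 hst.frob_root.symm, hst.inertia_root,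
      map_mul, hst.frob_root]
    have h2 := h.frob_pow_apply hN hst hξ.pow_eq_one 1
    rw [pow_one, pow_one] at h2
    rw [h2, ← h.inertia_pow_root hN hξ hst]
    exact (t ^ q).symm_apply_apply ϖ
  · exact fun x _ => h.sub_lt_mul (h.sub_lt_inv (h.sub_lt_pow hst.inertia_sub q))
      (h.sub_lt_conj hst.inertia_sub s) x

/-- The image of inertia is generated by the image of `t`. -/
theorem map_mem_zpowers (ρ : Gal(L/K) →ₜ* Γ) {σ : Gal(L/K)}
    (hσ : ∀ x, w x ≤ 1 → w (σ x - x) < 1) : ρ σ ∈ Subgroup.zpowers (ρ t) := by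
  obtain ⟨E, -, hE⟩ := h.exists_intermediateField_map_eq_one hN hϖ ρ ρ
  obtain ⟨i, hi⟩ := h.exists_pow_root hN hϖ hξ σ
  have h1 := (hE ((t ^ i)⁻¹ * σ) ?_ ?_).1
  · rw [map_mul, map_inv, inv_mul_eq_one, map_pow] at h1
    exact ⟨i, by simpa using h1⟩
  · rw [AlgEquiv.mul_apply, hi, ← h.inertia_pow_root hN hξ hst]
    exact (t ^ i).symm_apply_apply ϖ
  · exact fun x _ => h.sub_lt_mul (h.sub_lt_inv (h.sub_lt_pow hst.inertia_sub i)) hσ x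

variable [IsDomain R] [IsDiscreteValuationRing R] [Finite (IsLocalRing.ResidueField R)]
    [IsFractionRing R K] [IsScalarTower R K L]
    (hq : q = Nat.card (IsLocalRing.ResidueField R))
include hq

theorem tame_hom_ext {ρ ρ' : Gal(L/K) →ₜ* Γ} (hs : ρ s = ρ' s) (ht : ρ t = ρ' t) : ρ = ρ' := by
  obtain ⟨E, hEfin, hE⟩ := h.exists_intermediateField_map_eq_one hN hϖ ρ ρ'
  ext σ
  obtain ⟨i, j, hσ, hσE⟩ := h.exists_pow_mul_pow hN hϖ hξ hst hq E σ
  obtain ⟨h1, h2⟩ := hE _ hσ hσE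
  rw [map_mul, map_inv, inv_mul_eq_one, map_mul, map_pow, map_pow] at h1 h2
  rw [← h1, ← h2, hs, ht]

/-- Every solution of the tame relation comes from a homomorphism. -/
theorem exists_tame_hom {ζ : L} (hζ : IsPrimitiveRoot ζ (q ^ Nat.card Γ - 1))
    (hM : w ((q ^ Nat.card Γ - 1 : ℕ) : L) = 1) {x y : Γ} (hxy : x * y * x⁻¹ = y ^ q) :
    ∃ ρ : Gal(L/K) →ₜ* Γ, ρ s = x ∧ ρ t = y := by
  have hN0 : Nat.card Γ ≠ 0 := Nat.card_pos.ne'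
  have hϖ0 := h.root_ne_zero hN0 hϖ
  have hq2 : 2 ≤ q := by rw [hq]; exact Finite.one_lt_card
  choose a b hab hξb hζb using h.exists_pow_apply hN hϖ hξ hst hq hM hζ.pow_eq_one
  have hyuniq : ∀ {i i' : ℕ}, ξ ^ i * ϖ = ξ ^ i' * ϖ → y ^ i = y ^ i' := by
    intro i i' hii
    have h1 := mul_right_cancel₀ hϖ0 hii
    exact pow_eq_pow_iff_modEq.2 ((hξ.modEq_of_pow_eq hN0 h1).of_dvd (orderOf_dvd_natCard y))
  have hxuniq : ∀ {j j' : ℕ}, ζ ^ q ^ j = ζ ^ q ^ j' → x ^ j = x ^ j' := by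
    intro j j' hjj
    have hM0 : q ^ Nat.card Γ - 1 ≠ 0 := by intro h0; simp [h0] at hM
    exact pow_eq_pow_iff_modEq.2 ((Nat.modEq_of_pow_modEq_pow_sub_one hq2 hN0
      (hζ.modEq_of_pow_eq hM0 hjj)).of_dvd (orderOf_dvd_natCard x))
  have hval : ∀ {σ : Gal(L/K)} {i j : ℕ}, σ ϖ = ξ ^ i * ϖ → σ ζ = ζ ^ q ^ j →
      y ^ a σ * x ^ b σ = y ^ i * x ^ j := by
    intro σ i j h1 h2
    rw [hyuniq ((hab σ).symm.trans h1), hxuniq ((hζb σ).symm.trans h2)]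
  -- The exponents matter only modulo `|Γ|`, so they are well defined by `σ ϖ` and `σ ζ`. They
  -- compose as `a σ + q ^ b σ * a τ` and `b σ + b τ`, just as the relation between `x` and `y`
  -- demands.
  let ρ : Gal(L/K) →* Γ := MonoidHom.mk' (fun σ => y ^ a σ * x ^ b σ) (by
    intro σ τ
    rw [hval (σ := σ * τ) (i := a σ + q ^ b σ * a τ) (j := b σ + b τ), pow_add, pow_add,
      ← conj_pow_eq_pow hxy]
    · group
    · rw [AlgEquiv.mul_apply, hab τ, map_mul, map_pow, hξb, hab σ]
      ring
    · rw [AlgEquiv.mul_apply, hζb τ, map_pow, hζb σ, ← pow_mul, ← pow_add])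
  have hρ : Continuous ρ := by
    refine continuous_of_continuousAt_one ρ ?_
    rw [ContinuousAt, map_one, nhds_discrete Γ, Filter.tendsto_pure]
    filter_upwards [(stabilizer_isOpen_of_isIntegral (K := K) ϖ).mem_nhds (one_mem _),
      (stabilizer_isOpen_of_isIntegral (K := K) ζ).mem_nhds (one_mem _)] with σ h1 h2
    have h3 := hval (σ := σ) (i := 0) (j := 0) (by simpa using h1) (by simpa using h2)
    exact h3.trans (by simp)
  refine ⟨⟨ρ, hρ⟩, ?_, ?_⟩
  · have h1 := hval (σ := s) (i := 0) (j := 1) (by simpa using hst.frob_root)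
      (by simpa using h.frob_pow_apply hM hst hζ.pow_eq_one 1)
    exact h1.trans (by simp)
  · have h1 := hval (σ := t) (i := 1) (j := 0) (by simpa using hst.inertia_root)
      (by simpa using h.inertia_apply hM hst hζ.pow_eq_one)
    exact h1.trans (by simp)

end IsLocalNorm

namespace IsLocalNorm

variable {R K L : Type*} [CommRing R] [IsDomain R] [IsDiscreteValuationRing R]
    [Finite (IsLocalRing.ResidueField R)] [Field K] [Field L] [Algebra R K] [Algebra K L]
    [Algebra R L] [IsFractionRing R K] [IsScalarTower R K L] [IsGalois K L] [IsSepClosed L]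
    {w : AbsoluteValue L ℝ} {π : K}

/-- The bijection is evaluation at `(s, t)`. -/
theorem exists_tame_equiv (h : IsLocalNorm R K L w π) (Γ : Type*) [Group Γ] [Finite Γ]
    [TopologicalSpace Γ] [DiscreteTopology Γ]
    (hΓ : (Nat.card (IsLocalRing.ResidueField R)).Coprime (Nat.card Γ)) :
    ∃ e : (Gal(L/K) →ₜ* Γ) ≃
        {p : Γ × Γ // p.1 * p.2 * p.1⁻¹ = p.2 ^ Nat.card (IsLocalRing.ResidueField R)},
      ∀ ρ : Gal(L/K) →ₜ* Γ,
        ((Ring.jacobson (integralClosure R L)).inertia Gal(L/K)).map (ρ : Gal(L/K) →* Γ) =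
          Subgroup.zpowers (e ρ).1.2 := by
  set q := Nat.card (IsLocalRing.ResidueField R) with hq
  have hN0 : Nat.card Γ ≠ 0 := Nat.card_pos.ne'
  have hN : w (Nat.card Γ : L) = 1 := h.natCast_eq_one hΓ
  have hM : w ((q ^ Nat.card Γ - 1 : ℕ) : L) = 1 := by
    refine h.natCast_eq_one ?_
    have h1 : q.Coprime (q ^ Nat.card Γ - 1) := by
      have h2 := Nat.coprime_self_sub_right (n := q ^ Nat.card Γ) (m := 1)
        (Nat.one_le_pow _ _ Nat.card_pos)
      exact Nat.Coprime.coprime_dvd_left (dvd_pow_self q hN0) (h2.2 (Nat.coprime_one_right _))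
    exact h1
  have hNL : NeZero (Nat.card Γ : L) := ⟨fun h0 => by simp [h0] at hN⟩
  have hML : NeZero ((q ^ Nat.card Γ - 1 : ℕ) : L) := ⟨fun h0 => by rw [h0] at hM; simp at hM⟩
  obtain ⟨ϖ, hϖ⟩ := IsSepClosed.exists_pow_nat_eq (algebraMap K L π) (Nat.card Γ)
  obtain ⟨ξ, hξ⟩ := HasEnoughRootsOfUnity.exists_primitiveRoot L (Nat.card Γ)
  obtain ⟨ζ, hζ⟩ := HasEnoughRootsOfUnity.exists_primitiveRoot L (q ^ Nat.card Γ - 1)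
  obtain ⟨s, hs, hs'⟩ := h.exists_frobenius_fixing_root hN0 hϖ
  obtain ⟨t, ht, ht'⟩ := h.exists_inertia_mul_root hN0 hϖ hξ.pow_eq_one
  have hst : IsTamePair w q ϖ ξ s t := ⟨hs, hs', ht, ht'⟩
  let e : (Gal(L/K) →ₜ* Γ) → {p : Γ × Γ // p.1 * p.2 * p.1⁻¹ = p.2 ^ q} := fun ρ =>
    ⟨(ρ s, ρ t), h.map_frob_conj hN hϖ hξ hst ρ⟩
  have he : Function.Bijective e := by
    constructor
    · intro ρ ρ' hρ
      have h1 := congr_arg Subtype.val hρ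
      exact h.tame_hom_ext hN hϖ hξ hst hq (congr_arg Prod.fst h1) (congr_arg Prod.snd h1)
    · rintro ⟨⟨x, y⟩, hxy⟩
      obtain ⟨ρ, hρs, hρt⟩ := h.exists_tame_hom hN hϖ hξ hst hq hζ hM hxy
      exact ⟨ρ, Subtype.ext (Prod.ext hρs hρt)⟩
  refine ⟨Equiv.ofBijective e he, fun ρ => le_antisymm ?_ ?_⟩
  · rintro _ ⟨σ, hσ, rfl⟩
    exact h.map_mem_zpowers hN hϖ hξ hst ρ ((h.mem_inertia_iff σ).1 hσ)
  · rw [Subgroup.zpowers_le]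
    exact ⟨t, (h.mem_inertia_iff t).2 ht', rfl⟩

end IsLocalNorm

/-- The homomorphisms from the absolute Galois group of a local field `K` to a finite group of order
prime to `q_K` correspond to the solutions of the tame relation. -/
theorem exists_tame_equiv (K : Type u) [Field K] [ValuativeRel K] [TopologicalSpace K]
    [IsNonarchimedeanLocalField K] (Γ : Type v) [Group Γ] [Finite Γ] [TopologicalSpace Γ]
    [DiscreteTopology Γ] (hΓ : (residueCard K).Coprime (Nat.card Γ)) :
    ∃ e : (AbsGal K →ₜ* Γ) ≃ {p : Γ × Γ // p.1 * p.2 * p.1⁻¹ = p.2 ^ residueCard K},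
      ∀ ρ : AbsGal K →ₜ* Γ,
        (inertiaGroup K).map (ρ : AbsGal K →* Γ) = Subgroup.zpowers (e ρ).1.2 := by
  obtain ⟨w, π, h⟩ := exists_isLocalNorm K
  exact h.exists_tame_equiv Γ hΓ

/-! ### Rational characters and conjugacy of powers. -/

theorem Module.End.pow_apply_of_mem_eigenspace {R M : Type*} [CommRing R] [AddCommGroup M]
    [Module R M] {f : Module.End R M} {μ : R} {x : M} (hx : x ∈ f.eigenspace μ) (a : ℕ) :
    (f ^ a) x = μ ^ a • x := by
  induction a with
  | zero => simp
  | succ a ih =>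
    rw [pow_succ', Module.End.mul_apply, ih, map_smul, Module.End.mem_eigenspace_iff.1 hx,
      smul_smul, ← pow_succ]

/-- The traces of the powers of an automorphism of order dividing `n` are the values of a
polynomial at the powers of a primitive `n`-th root of unity. -/
theorem exists_polynomial_trace_pow {V : Type*} [AddCommGroup V] [Module ℂ V]
    [FiniteDimensional ℂ V] (f : Module.End ℂ V) {n : ℕ} (hn : n ≠ 0) (hf : f ^ n = 1) {ζ : ℂ}
    (hζ : IsPrimitiveRoot ζ n) :
    ∃ P : ℚ[X], ∀ a : ℕ, LinearMap.trace ℂ V (f ^ a) = aeval (ζ ^ a) P := by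
  have : NeZero n := ⟨hn⟩
  have hss : f.IsSemisimple := by
    refine Module.End.isSemisimple_of_squarefree_aeval_eq_zero (p := X ^ n - 1) ?_ (by simp [hf])
    exact (separable_X_pow_sub_C (1 : ℂ) (by exact_mod_cast hn) one_ne_zero).squarefree
  have htop : ⨆ μ, f.eigenspace μ = ⊤ := by
    rw [← hss.isFinitelySemisimple.iSup_maxGenEigenspace_eq_top_iff]
    exact f.iSup_maxGenEigenspace_eq_top
  have hint : DirectSum.IsInternal f.eigenspace :=
    DirectSum.isInternal_submodule_of_iSupIndep_of_iSup_eq_top f.eigenspaces_iSupIndep htop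
  have hfin : {μ | f.eigenspace μ ≠ ⊥}.Finite :=
    WellFoundedGT.finite_ne_bot_of_iSupIndep f.eigenspaces_iSupIndep
  have hk : ∀ μ : ℂ, ∃ k : ℕ, f.eigenspace μ ≠ ⊥ → μ = ζ ^ k := by
    intro μ
    by_cases hμ : f.eigenspace μ = ⊥
    · exact ⟨0, fun h => absurd hμ h⟩
    obtain ⟨x, hx, hx0⟩ := (Submodule.ne_bot_iff _).1 hμ
    have h2 := Module.End.pow_apply_of_mem_eigenspace hx n
    rw [hf, Module.End.one_apply] at h2
    have h3 : μ ^ n = 1 := by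
      have h4 : (μ ^ n - 1) • x = 0 := by rw [sub_smul, one_smul, ← h2, sub_self]
      exact sub_eq_zero.1 ((smul_eq_zero.1 h4).resolve_right hx0)
    obtain ⟨k, -, hk⟩ := hζ.eq_pow_of_pow_eq_one h3
    exact ⟨k, fun _ => hk.symm⟩
  choose k hk using hk
  -- Each eigenvalue is a power `ζ ^ k μ`, weighted by its multiplicity.
  refine ⟨∑ μ ∈ hfin.toFinset, (Module.finrank ℂ (f.eigenspace μ) : ℚ[X]) * X ^ k μ, fun a => ?_⟩
  have hmaps : ∀ μ, Set.MapsTo (f ^ a) (f.eigenspace μ) (f.eigenspace μ) := fun μ =>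
    f.mapsTo_genEigenspace_of_comm (Commute.pow_self f a).symm μ 1
  rw [LinearMap.trace_eq_sum_trace_restrict' hint hfin hmaps, map_sum]
  refine Finset.sum_congr rfl fun μ hμ => ?_
  have hμ' : μ = ζ ^ k μ := hk μ (by simpa using hμ)
  have h1 : (f ^ a).restrict (hmaps μ) = μ ^ a • LinearMap.id := by
    ext ⟨x, hx⟩
    exact Module.End.pow_apply_of_mem_eigenspace hx a
  rw [h1, map_smul, LinearMap.trace_id, map_mul, map_natCast, map_pow, aeval_X, smul_eq_mul,
    mul_comm, ← pow_mul, mul_comm a, pow_mul, ← hμ']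

/-- A rational polynomial that takes a rational value at a primitive root of unity takes the same
value at the conjugates. -/
theorem aeval_pow_eq_of_aeval_eq_rat {n : ℕ} (hn : n ≠ 0) {ζ : ℂ} (hζ : IsPrimitiveRoot ζ n)
    {P : ℚ[X]} {r : ℚ} (hr : aeval ζ P = r) {a : ℕ} (ha : a.Coprime n) : aeval (ζ ^ a) P = r := by
  have h1 : aeval ζ (P - C r) = 0 := by simp [hr]
  have h2 := minpoly.dvd ℚ ζ h1
  rw [← cyclotomic_eq_minpoly_rat hζ (Nat.pos_of_ne_zero hn),
    cyclotomic_eq_minpoly_rat (hζ.pow_of_coprime a ha) (Nat.pos_of_ne_zero hn)] at h2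
  obtain ⟨Q, hQ⟩ := h2
  have h3 : aeval (ζ ^ a) (P - C r) = 0 := by rw [hQ, map_mul, minpoly.aeval, zero_mul]
  simpa [sub_eq_zero] using h3

/-- A rational polynomial that takes a single value at the conjugates of a primitive root of unity
takes a rational value there. -/
theorem exists_rat_of_aeval_pow_eq {n : ℕ} (hn : n ≠ 0) {ζ c : ℂ} (hζ : IsPrimitiveRoot ζ n)
    {P : ℚ[X]} (hP : ∀ a : ℕ, a.Coprime n → aeval (ζ ^ a) P = c) : ∃ r : ℚ, c = r := by
  have : NeZero n := ⟨hn⟩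
  have hmon := cyclotomic.monic n ℚ
  have hroot : ∀ z ∈ primitiveRoots n ℂ, aeval z (P %ₘ cyclotomic n ℚ) = c := by
    intro z hz
    rw [mem_primitiveRoots (Nat.pos_of_ne_zero hn)] at hz
    rw [cyclotomic_eq_minpoly_rat hz (Nat.pos_of_ne_zero hn), minpoly.aeval_modByMonic_minpoly]
    obtain ⟨a, -, ha, rfl⟩ := hζ.isPrimitiveRoot_iff.1 hz
    exact hP a ha
  have hdeg : (P %ₘ cyclotomic n ℚ).natDegree < n.totient := by
    have h1 := natDegree_modByMonic_lt P hmon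
      (fun h0 => by
        have h2 := natDegree_cyclotomic n ℚ
        rw [h0, natDegree_one] at h2
        exact (Nat.totient_pos.2 (Nat.pos_of_ne_zero hn)).ne h2)
    rwa [natDegree_cyclotomic] at h1
  -- The remainder has degree below `φ(n)` and takes the value `c` at all `φ(n)` primitive roots, so
  -- it is constant.
  have h0 : (P %ₘ cyclotomic n ℚ).map (algebraMap ℚ ℂ) - C c = 0 := by
    refine eq_zero_of_natDegree_lt_card_of_eval_eq_zero' _ (primitiveRoots n ℂ) ?_ ?_
    · intro z hz
      rw [eval_sub, eval_C, eval_map_algebraMap, hroot z hz, sub_self]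
    · rw [hζ.card_primitiveRoots]
      rwa [natDegree_sub_C, natDegree_map]
  refine ⟨(P %ₘ cyclotomic n ℚ).coeff 0, ?_⟩
  have h1 := congr_arg (fun p => coeff p 0) h0
  simp only [coeff_sub, coeff_map, coeff_C_zero, coeff_zero, sub_eq_zero] at h1
  rw [← h1]
  simp

theorem exists_polynomial_character_pow {Γ : Type*} [Group Γ] [Finite Γ] {V : Type*}
    [AddCommGroup V] [Module ℂ V] [FiniteDimensional ℂ V] (π : Representation ℂ Γ V) {ζ : ℂ}
    (hζ : IsPrimitiveRoot ζ (Nat.card Γ)) (g : Γ) :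
    ∃ P : ℚ[X], ∀ a : ℕ, π.character (g ^ a) = aeval (ζ ^ a) P := by
  obtain ⟨P, hP⟩ := exists_polynomial_trace_pow (π g) Nat.card_pos.ne'
    (by rw [← map_pow, pow_card_eq_one', map_one]) hζ
  exact ⟨P, fun a => by rw [← hP, ← map_pow]; rfl⟩

/-- If every element is conjugate to its powers prime to the order of the group, then all
character values are rational. -/
theorem hasRationalCharacterTable_of_isConj_pow {Γ : Type v} [Group Γ] [Finite Γ]
    (h : ∀ (y : Γ) (a : ℕ), a.Coprime (Nat.card Γ) → IsConj y (y ^ a)) :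
    HasRationalCharacterTable Γ := by
  intro V _ _ _ π _ g
  have hζ := Complex.isPrimitiveRoot_exp (Nat.card Γ) Nat.card_pos.ne'
  obtain ⟨P, hP⟩ := exists_polynomial_character_pow π hζ g
  refine exists_rat_of_aeval_pow_eq (P := P) Nat.card_pos.ne' hζ fun a ha => ?_
  rw [← hP]
  obtain ⟨x, hx⟩ := isConj_iff.1 (h g a ha)
  rw [← hx, Representation.char_conj]

/-- A central element of the group algebra whose trace on an irreducible representation vanishes
acts on it as zero. -/
theorem Representation.asAlgebraHom_eq_zero_of_trace {Γ : Type*} [Group Γ] {z : ℂ[Γ]}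
    (hz : ∀ a, z * a = a * z) {V : Type*} [AddCommGroup V] [Module ℂ V] [FiniteDimensional ℂ V]
    (π : Representation ℂ Γ V) [π.IsIrreducible]
    (h : LinearMap.trace ℂ V (π.asAlgebraHom z) = 0) : π.asAlgebraHom z = 0 := by
  let f : Representation.IntertwiningMap π π := ⟨π.asAlgebraHom z, fun g => by
    rw [← π.asAlgebraHom_of g, ← Module.End.mul_eq_comp, ← Module.End.mul_eq_comp, ← map_mul,
      ← map_mul, hz]⟩
  have hb : Function.Bijective (algebraMap ℂ (Representation.IntertwiningMap π π)) :=
    Representation.IsIrreducible.algebraMap_intertwiningMap_bijective_of_isAlgClosed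
  -- By Schur's lemma `z` acts as a scalar `c`, with trace `c * dim V`.
  obtain ⟨c, hc⟩ := hb.2 f
  have hc' : π.asAlgebraHom z = c • LinearMap.id := by
    change f.toLinearMap = _
    rw [← hc]
    rfl
  rw [hc', map_smul, LinearMap.trace_id, smul_eq_zero] at h
  rcases h with h | h
  · rw [hc', h, zero_smul]
  · have h0 : Module.finrank ℂ V = 0 := by exact_mod_cast h
    have := Module.finrank_zero_iff.1 h0
    exact Subsingleton.elim _ _

/-- A central element of the group algebra whose trace vanishes on all irreducible representations
annihilates all finite-dimensional simple modules. -/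
theorem smul_eq_zero_of_forall_trace_eq_zero {Γ : Type v} [Group Γ] {z : ℂ[Γ]}
    (hz : ∀ a, z * a = a * z)
    (h : ∀ (V : Type) [AddCommGroup V] [Module ℂ V] [FiniteDimensional ℂ V]
      (π : Representation ℂ Γ V), π.IsIrreducible → LinearMap.trace ℂ V (π.asAlgebraHom z) = 0)
    {M : Type*} [AddCommGroup M] [Module ℂ M] [Module ℂ[Γ] M] [IsScalarTower ℂ ℂ[Γ] M]
    [FiniteDimensional ℂ M] [IsSimpleModule ℂ[Γ] M] (m : M) : z • m = 0 := by
  -- The hypothesis covers only spaces in `Type`, so the action is transported to a coordinate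
  -- space.
  let b : M ≃ₗ[ℂ] (Fin (Module.finrank ℂ M) → ℂ) := (Module.finBasis ℂ M).equivFun
  let φ : ℂ[Γ] →ₐ[ℂ] Module.End ℂ (Fin (Module.finrank ℂ M) → ℂ) :=
    (b.conjAlgEquiv ℂ).toAlgHom.comp (Algebra.lsmul ℂ ℂ M)
  have hφ : ∀ r x, φ r x = b (r • b.symm x) := fun _ _ => rfl
  let π : Representation ℂ Γ (Fin (Module.finrank ℂ M) → ℂ) := (MonoidAlgebra.lift ℂ _ Γ).symm φ
  have hπ : π.asAlgebraHom = φ := (MonoidAlgebra.lift ℂ _ Γ).apply_symm_apply φ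
  clear_value φ b
  let e : π.asModule ≃ₗ[ℂ[Γ]] M :=
    { π.asModuleEquiv.toAddEquiv.trans b.symm.toAddEquiv with
      map_smul' := fun r x => by
        change b.symm (π.asModuleEquiv (r • x)) = r • b.symm (π.asModuleEquiv x)
        rw [π.asModuleEquiv_map_smul, hπ, hφ, b.symm_apply_apply] }
  have hirr : π.IsIrreducible := by
    rw [Representation.irreducible_iff_isSimpleModule_asModule]
    exact IsSimpleModule.congr e
  have h0 := Representation.asAlgebraHom_eq_zero_of_trace hz π (h _ π hirr)
  have h1 : φ z (b m) = 0 := by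
    rw [← hπ, h0]
    rfl
  rwa [hφ, b.symm_apply_apply, map_eq_zero_iff b b.injective] at h1

/-- If the trace of a central element of the group algebra vanishes on all irreducible
representations, then so does the element. -/
theorem eq_zero_of_forall_trace_eq_zero {Γ : Type v} [Group Γ] [Finite Γ] {z : ℂ[Γ]}
    (hz : ∀ a, z * a = a * z)
    (h : ∀ (V : Type) [AddCommGroup V] [Module ℂ V] [FiniteDimensional ℂ V]
      (π : Representation ℂ Γ V), π.IsIrreducible → LinearMap.trace ℂ V (π.asAlgebraHom z) = 0) :
    z = 0 := by
  have : NeZero (Nat.card Γ : ℂ) := ⟨by exact_mod_cast Nat.card_pos.ne'⟩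
  -- `z` kills every simple quotient `ℂ[Γ] ⧸ m`, hence lies in the Jacobson radical, which is zero
  -- by Maschke's theorem.
  have hmem : z ∈ Ring.jacobson ℂ[Γ] := by
    rw [Ring.jacobson, Module.jacobson, Submodule.mem_sInf]
    intro m hm
    have hM : IsSimpleModule ℂ[Γ] (ℂ[Γ] ⧸ m) := isSimpleModule_iff_isCoatom.2 hm
    have hfin : FiniteDimensional ℂ (ℂ[Γ] ⧸ m) :=
      Module.Finite.of_surjective ((m.mkQ).restrictScalars ℂ) m.mkQ_surjective
    have h2 := smul_eq_zero_of_forall_trace_eq_zero hz h (Submodule.Quotient.mk (p := m) 1)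
    rwa [← Submodule.Quotient.mk_smul, smul_eq_mul, mul_one, Submodule.Quotient.mk_eq_zero] at h2
  rwa [IsSemisimpleRing.jacobson_eq_bot] at hmem

/-- The irreducible complex characters of a finite group separate its conjugacy classes. -/
theorem isConj_of_forall_character_eq {Γ : Type v} [Group Γ] [Finite Γ] {x y : Γ}
    (h : ∀ (V : Type) [AddCommGroup V] [Module ℂ V] [FiniteDimensional ℂ V]
      (π : Representation ℂ Γ V), π.IsIrreducible → π.character x = π.character y) :
    IsConj x y := by
  classical
  have := Fintype.ofFinite Γ
  -- A multiple of the class sum: central, with trace `|Γ| χ(x)`. Its coefficients count conjugating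
  -- elements, so `S x = S y` forces conjugacy.
  let S : Γ → ℂ[Γ] := fun x => ∑ g : Γ, MonoidAlgebra.single (g * x * g⁻¹) 1
  have hS : ∀ x a, S x * a = a * S x := by
    intro x a
    induction a using MonoidAlgebra.induction_on with
    | of k =>
      simp only [S, Finset.sum_mul, Finset.mul_sum, MonoidAlgebra.of_apply,
        MonoidAlgebra.single_mul_single, mul_one]
      rw [← Equiv.sum_comp (Equiv.mulLeft k)]
      refine Finset.sum_congr rfl fun g _ => ?_
      congr 1
      simp only [Equiv.coe_mulLeft]
      group
    | add a b ha hb => rw [mul_add, add_mul, ha, hb]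
    | smul r a ha => rw [mul_smul_comm, smul_mul_assoc, ha]
  have htr : ∀ (V : Type) [AddCommGroup V] [Module ℂ V] [FiniteDimensional ℂ V]
      (π : Representation ℂ Γ V) (x : Γ), LinearMap.trace ℂ V (π.asAlgebraHom (S x)) =
        Fintype.card Γ * π.character x := by
    intro V _ _ _ π x
    simp only [S, map_sum, Representation.asAlgebraHom_single, one_smul]
    exact (Finset.sum_congr rfl fun g _ => π.char_conj x g).trans (by simp)
  have h0 : S x - S y = 0 := by
    refine eq_zero_of_forall_trace_eq_zero (fun a => ?_) fun V _ _ _ π hπ => ?_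
    · rw [sub_mul, mul_sub, hS, hS]
    · rw [map_sub, map_sub, htr, htr, h V π hπ, sub_self]
  by_contra hxy
  have h1 := congr_arg (fun s : ℂ[Γ] => s.coeff x) (sub_eq_zero.1 h0)
  have h2 : ∀ z, (S z).coeff x = ((Finset.univ.filter fun g : Γ => g * z * g⁻¹ = x).card : ℂ) := by
    intro z
    simp [S, MonoidAlgebra.coeff_sum, Finsupp.finsetSum_apply, Finsupp.single_apply]
  simp only [h2] at h1
  rw [Finset.filter_false_of_mem (s := Finset.univ) (p := fun g : Γ => g * y * g⁻¹ = x) fun g _ hg =>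
    hxy (isConj_iff.2 ⟨g, hg⟩).symm] at h1
  simp only [Finset.card_empty, Nat.cast_zero, Nat.cast_eq_zero, Finset.card_eq_zero] at h1
  exact absurd (h1 ▸ Finset.mem_filter.2 ⟨Finset.mem_univ (1 : Γ), by simp⟩)
    (Finset.notMem_empty _)

theorem hasRationalCharacterTable_iff {Γ : Type v} [Group Γ] [Finite Γ] :
    HasRationalCharacterTable Γ ↔
      ∀ (y : Γ) (a : ℕ), a.Coprime (Nat.card Γ) → IsConj y (y ^ a) := by
  refine ⟨fun h y a ha => isConj_of_forall_character_eq fun V _ _ _ π hπ => ?_,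
    hasRationalCharacterTable_of_isConj_pow⟩
  have hζ := Complex.isPrimitiveRoot_exp (Nat.card Γ) Nat.card_pos.ne'
  obtain ⟨P, hP⟩ := exists_polynomial_character_pow π hζ y
  obtain ⟨r, hr⟩ := h V π hπ y
  have h1 := hP 1
  rw [pow_one, pow_one, hr] at h1
  rw [hr, hP, aeval_pow_eq_of_aeval_eq_rat Nat.card_pos.ne' hζ h1.symm ha]

/-! ### Local fields with prime residue cardinality. -/

/-- A field that is isomorphic, as a topological field with a valuation, to a non-trivially normed
locally compact field is a local field. -/
theorem IsNonarchimedeanLocalField.of_ringEquiv {K F : Type*} [Field K] [ValuativeRel K]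
    [TopologicalSpace K] [NontriviallyNormedField F] [LocallyCompactSpace F] (e : K ≃+* F)
    (he : IsHomeomorph e) (hv : ∀ x y : K, x ≤ᵥ y ↔ ‖e x‖ ≤ ‖e y‖) :
    IsNonarchimedeanLocalField K := by
  have hle : ∀ x y : K, ValuativeRel.valuation K x ≤ ValuativeRel.valuation K y ↔
      ‖e x‖ ≤ ‖e y‖ := fun x y =>
    ((ValuativeRel.valuation K).vle_iff_le).symm.trans (hv x y)
  have hlt : ∀ x y : K, ValuativeRel.valuation K x < ValuativeRel.valuation K y ↔
      ‖e x‖ < ‖e y‖ := fun x y => by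
    rw [← not_le, hle, not_le]
  have hadd : ContinuousConstVAdd K K := ⟨fun c => by
    rw [he.isInducing.continuous_iff]
    have : e ∘ (c +ᵥ ·) = fun x => e c + e x := funext fun x => map_add e c x
    rw [this]
    exact continuous_const.add he.continuous⟩
  have htop : IsValuativeTopology K := by
    refine IsValuativeTopology.of_zero fun s => ?_
    have hb := (Metric.nhds_basis_ball (x := (0 : F))).comap e
    rw [← map_zero e, ← he.isInducing.nhds_eq_comap] at hb
    rw [hb.mem_iff]
    constructor
    · rintro ⟨r, hr, hs⟩
      obtain ⟨y, hy0, hy⟩ := NormedField.exists_norm_lt F hr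
      refine ⟨Units.mk0 (ValuativeRel.valuation K (e.symm y)) ?_, fun z hz => hs ?_⟩
      · simpa using norm_pos_iff.1 hy0
      · have h1 : ‖e z‖ < ‖e (e.symm y)‖ := (hlt _ _).1 hz
        rw [e.apply_symm_apply] at h1
        simpa using h1.trans hy
    · rintro ⟨γ, hγ⟩
      obtain ⟨y, hy⟩ := ValuativeRel.valuation_surjective (γ : ValuativeRel.ValueGroupWithZero K)
      have hy0 : y ≠ 0 := fun h => γ.ne_zero (by rw [← hy, h, map_zero])
      refine ⟨‖e y‖, norm_pos_iff.2 (by simpa using hy0), fun z hz => hγ ?_⟩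
      rw [Set.mem_ofPred_eq, ← hy, hlt]
      simpa using hz
  have hnt : ValuativeRel.IsNontrivial K := by
    obtain ⟨y, hy0, hy⟩ := NormedField.exists_norm_lt_one F
    refine ⟨ValuativeRel.valuation K (e.symm y), ?_, ne_of_lt ?_⟩
    · simpa using norm_pos_iff.1 hy0
    · rw [← map_one (ValuativeRel.valuation K), hlt]
      simpa using hy
  have hlc : LocallyCompactSpace K := he.isClosedEmbedding.locallyCompactSpace
  exact {}

/-- Every prime number is the residue cardinality of a local field. -/
theorem exists_residueCard_eq (p : ℕ) [Fact p.Prime] :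
    ∃ (K : Type u) (_ : Field K) (_ : ValuativeRel K) (_ : TopologicalSpace K)
      (_ : IsNonarchimedeanLocalField K), residueCard K = p := by
  -- `ℚ_[p]` is lifted to the universe `u` over which mass formulas quantify.
  let e : ULift.{u} ℚ_[p] ≃+* ℚ_[p] := ULift.ringEquiv
  let i : ValuativeRel (ULift.{u} ℚ_[p]) :=
    .ofValuation ((NormedField.valuation (K := ℚ_[p])).comap (e : ULift.{u} ℚ_[p] →+* ℚ_[p]))
  have hv : ∀ x y : ULift.{u} ℚ_[p], x ≤ᵥ y ↔ ‖e x‖ ≤ ‖e y‖ := fun x y => Iff.rfl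
  have hloc : IsNonarchimedeanLocalField (ULift.{u} ℚ_[p]) :=
    .of_ringEquiv e Homeomorph.ulift.isHomeomorph hv
  refine ⟨ULift.{u} ℚ_[p], inferInstance, i, inferInstance, hloc, ?_⟩
  have hmem : ∀ x : ULift.{u} ℚ_[p], x ∈ 𝒪[ULift.{u} ℚ_[p]] ↔ e x ∈ PadicInt.subring p := by
    intro x
    rw [Valuation.mem_integer_iff, ← map_one (ValuativeRel.valuation (ULift.{u} ℚ_[p])),
      ← (ValuativeRel.valuation (ULift.{u} ℚ_[p])).vle_iff_le, hv, map_one, norm_one]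
    rfl
  let e' : 𝒪[ULift.{u} ℚ_[p]] ≃+* ℤ_[p] := 
    { toFun := fun x => ⟨e x, (hmem _).1 x.2⟩
      invFun := fun y => ⟨e.symm y, (hmem _).2 (by simpa using y.2)⟩
      left_inv := fun x => Subtype.ext (e.symm_apply_apply _)
      right_inv := fun x => Subtype.ext (e.apply_symm_apply _)
      map_add' := fun x y => Subtype.ext (map_add e _ _)
      map_mul' := fun x y => Subtype.ext (map_mul e _ _) }
  rw [residueCard, Nat.card_congr ((IsLocalRing.ResidueField.mapEquiv e').trans
    PadicInt.residueField).toEquiv, Nat.card_zmod]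

/-! ### The mass as a polynomial, and the main theorem. -/

/-- The number of elements conjugating `y` to a conjugate `z`. -/
theorem card_conj_eq_of_isConj {Γ : Type*} [Group Γ] [Fintype Γ] [DecidableEq Γ] {y z : Γ}
    (h : IsConj y z) : (Finset.univ.filter fun x : Γ => x * y * x⁻¹ = z).card =
      (Finset.univ.filter fun x : Γ => x * y * x⁻¹ = y).card := by
  obtain ⟨g, rfl⟩ := isConj_iff.1 h
  refine Finset.card_equiv (Equiv.mulLeft g⁻¹) fun x => ?_
  simp only [Finset.mem_filter, Finset.mem_univ, true_and, Equiv.coe_mulLeft]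
  constructor
  · intro hx
    calc g⁻¹ * x * y * (g⁻¹ * x)⁻¹ = g⁻¹ * (x * y * x⁻¹) * g := by group
      _ = y := by rw [hx]; group
  · intro hx
    calc x * y * x⁻¹ = g * (g⁻¹ * x * y * (g⁻¹ * x)⁻¹) * g⁻¹ := by group
      _ = g * y * g⁻¹ := by rw [hx]

/-- The generating polynomial of the pairs `(x, y)` with `x y x⁻¹ = y ^ a`, with respect to a
weight of `y`. -/
noncomputable def tamePolynomial {Γ : Type*} [Group Γ] [Fintype Γ] [DecidableEq Γ] (w : Γ → ℕ)
    (a : ℕ) : ℤ[X] :=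
  ∑ p : {p : Γ × Γ // p.1 * p.2 * p.1⁻¹ = p.2 ^ a}, X ^ w p.1.2

theorem tamePolynomial_eq_sum {Γ : Type*} [Group Γ] [Fintype Γ] [DecidableEq Γ] (w : Γ → ℕ)
    (a : ℕ) : tamePolynomial w a =
      ∑ y, (Finset.univ.filter fun x : Γ => x * y * x⁻¹ = y ^ a).card • X ^ w y := by
  rw [tamePolynomial, ← Finset.sum_subtype
    (Finset.univ.filter fun p : Γ × Γ => p.1 * p.2 * p.1⁻¹ = p.2 ^ a) (fun p => by simp)
    (fun p => X ^ w p.2), Finset.sum_filter, Fintype.sum_prod_type_right]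
  exact Finset.sum_congr rfl fun y _ => by
    simp only [← Finset.sum_filter, Finset.sum_const]

theorem tamePolynomial_congr {Γ : Type*} [Group Γ] [Fintype Γ] [DecidableEq Γ] (w : Γ → ℕ)
    {a b : ℕ} (h : a ≡ b [MOD Nat.card Γ]) : tamePolynomial w a = tamePolynomial w b := by
  have hy : ∀ y : Γ, y ^ a = y ^ b := fun y => by
    rw [← pow_mod_natCard, h, pow_mod_natCard]
  simp only [tamePolynomial_eq_sum, hy]

namespace CountingFunction

/-- The values of a proper counting function only depend on a generator of the image of inertia. -/
theorem IsProper.exists_weight {Γ : Type v} [Group Γ] [TopologicalSpace Γ]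
    {c : CountingFunction.{u, v} Γ} (hc : c.IsProper) :
    ∃ w : Γ → ℕ, ∀ (K : Type u) [Field K] [ValuativeRel K] [TopologicalSpace K]
      [IsNonarchimedeanLocalField K], (residueCard K).Coprime (Nat.card Γ) →
      ∀ (ρ : AbsGal K →ₜ* Γ) (y : Γ),
        (inertiaGroup K).map (ρ : AbsGal K →* Γ) = Subgroup.zpowers y → c.toFun ρ = w y := by
  suffices h : ∀ y : Γ, ∃ m : ℕ, ∀ (K : Type u) [Field K] [ValuativeRel K] [TopologicalSpace K]
      [IsNonarchimedeanLocalField K], (residueCard K).Coprime (Nat.card Γ) →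
      ∀ ρ : AbsGal K →ₜ* Γ,
        (inertiaGroup K).map (ρ : AbsGal K →* Γ) = Subgroup.zpowers y → c.toFun ρ = m by
    choose w hw using h
    exact ⟨w, fun K _ _ _ _ hK ρ y hρ => hw y K hK ρ hρ⟩
  intro y
  by_cases h : ∃ (K : Type u) (_ : Field K) (_ : ValuativeRel K) (_ : TopologicalSpace K)
      (_ : IsNonarchimedeanLocalField K) (ρ : AbsGal K →ₜ* Γ),
      (residueCard K).Coprime (Nat.card Γ) ∧
        (inertiaGroup K).map (ρ : AbsGal K →* Γ) = Subgroup.zpowers y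
  · obtain ⟨K', _, _, _, _, ρ', hK', hρ'⟩ := h
    exact ⟨c.toFun ρ', fun K _ _ _ _ hK ρ hρ => hc K K' ρ ρ' hK hK' (hρ.trans hρ'.symm)⟩
  -- If `⟨y⟩` never occurs as an image of inertia, the weight is arbitrary.
  · exact ⟨0, fun K _ _ _ _ hK ρ hρ => (h ⟨K, _, _, _, _, ρ, hK, hρ⟩).elim⟩

/-- The total mass of a local field of residue characteristic prime to `|Γ|`. -/
theorem IsProper.exists_totalMass_eq {Γ : Type v} [Group Γ] [Fintype Γ] [DecidableEq Γ]
    [TopologicalSpace Γ] [DiscreteTopology Γ] {c : CountingFunction.{u, v} Γ} (hc : c.IsProper) :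
    ∃ w : Γ → ℕ, ∀ (K : Type u) [Field K] [ValuativeRel K] [TopologicalSpace K]
      [IsNonarchimedeanLocalField K], (residueCard K).Coprime (Nat.card Γ) →
      c.totalMass K ≠ ∞ ∧ (c.totalMass K).toReal =
        aeval (1 / (residueCard K : ℝ)) (tamePolynomial w (residueCard K)) := by
  obtain ⟨w, hw⟩ := hc.exists_weight
  refine ⟨w, fun K _ _ _ _ hK => ?_⟩
  obtain ⟨e, he⟩ := exists_tame_equiv K Γ hK
  have hq : residueCard K ≠ 0 := by
    have : Finite 𝓀[K] := inferInstance
    exact Nat.card_pos.ne'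
  have hmass : c.totalMass K =
      ∑ p : {p : Γ × Γ // p.1 * p.2 * p.1⁻¹ = p.2 ^ residueCard K},
        ((residueCard K : ℝ≥0∞) ^ w p.1.2)⁻¹ := by
    rw [totalMass, ← tsum_fintype (L := SummationFilter.unconditional _), ← e.tsum_eq]
    exact tsum_congr fun ρ => by rw [hw K hK ρ _ (he ρ)]
  have hfin : ∀ m : ℕ, ((residueCard K : ℝ≥0∞) ^ m)⁻¹ ≠ ∞ := fun m =>
    ENNReal.inv_ne_top.2 (pow_ne_zero _ (Nat.cast_ne_zero.2 hq))
  rw [hmass]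
  refine ⟨ENNReal.sum_ne_top.2 fun p _ => hfin _, ?_⟩
  rw [ENNReal.toReal_sum fun p _ => hfin _, tamePolynomial, map_sum]
  refine Finset.sum_congr rfl fun p _ => ?_
  simp

end CountingFunction

theorem mainTheorem4 {Γ : Type v} [Group Γ] [Finite Γ] [TopologicalSpace Γ] [DiscreteTopology Γ]
    (c : CountingFunction.{u, v} Γ) (hc : c.IsProper) :
    c.HasMassFormula (fun K _ _ _ _ => (residueCard K).Coprime (Nat.card Γ)) ↔
      HasRationalCharacterTable Γ := by
  classical
  have := Fintype.ofFinite Γ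
  obtain ⟨w, hw⟩ := hc.exists_totalMass_eq
  rw [hasRationalCharacterTable_iff]
  constructor
  · rintro ⟨f, hf⟩ 
    have key : ∀ a : ℕ, a.Coprime (Nat.card Γ) → tamePolynomial w a = f := by
      intro a ha
      -- Dirichlet's theorem: the two polynomials agree at `1 / p` for infinitely many primes `p`.
      have hinf : {p : ℕ | p.Prime ∧ p ≡ a [MOD Nat.card Γ]}.Infinite :=
        Set.infinite_of_forall_exists_gt fun n => by
          obtain ⟨p, hp, hpr, hmod⟩ := Nat.forall_exists_prime_gt_and_modEq n Nat.card_pos.ne' ha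
          exact ⟨p, ⟨hpr, hmod⟩, hp⟩
      refine Polynomial.map_injective (Int.castRingHom ℝ) Int.cast_injective
        (Polynomial.eq_of_infinite_eval_eq _ _ ((hinf.image (f := fun p : ℕ => 1 / (p : ℝ))
          fun p _ q _ h => by simpa using h).mono ?_))
      rintro _ ⟨p, ⟨hp, hpa⟩, rfl⟩
      have : Fact p.Prime := ⟨hp⟩
      obtain ⟨K, _, _, _, _, hK⟩ := exists_residueCard_eq.{u} p
      have hcop : (residueCard K).Coprime (Nat.card Γ) := by
        rw [hK, Nat.Coprime, hpa.gcd_eq]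
        exact ha
      have h1 := (hw K hcop).2.symm.trans (hf K hcop).2
      rw [hK, tamePolynomial_congr w hpa] at h1
      simpa [aeval_def, eval₂_eq_eval_map] using h1
    intro y a ha
    -- Evaluation at `1` forgets the weights and compares numbers of pairs for exponents `a` and
    -- `1`. Each `y` contributes at most as much for `a` as for `1`, so equality of the totals holds
    -- term by term.
    have h1 := congr_arg (eval 1) ((key a ha).trans (key 1 (Nat.coprime_one_left _)).symm)
    simp only [tamePolynomial_eq_sum, eval_finsetSum, nsmul_eq_mul, eval_mul, eval_natCast,
      eval_pow, eval_X, one_pow, pow_one, mul_one] at h1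
    have hle : ∀ z ∈ Finset.univ, (Finset.univ.filter fun x : Γ => x * z * x⁻¹ = z ^ a).card ≤
        (Finset.univ.filter fun x : Γ => x * z * x⁻¹ = z).card := fun z _ => by
      by_cases hz : IsConj z (z ^ a)
      · exact (card_conj_eq_of_isConj hz).le
      · rw [Finset.filter_false_of_mem fun x _ hx => hz (isConj_iff.2 ⟨x, hx⟩)]
        exact Nat.zero_le _
    have h2 := (Finset.sum_eq_sum_iff_of_le hle).1 (by exact_mod_cast h1) y (Finset.mem_univ _)
    obtain ⟨x, hx⟩ := Finset.card_pos.1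
      (h2.symm ▸ Finset.card_pos.2 ⟨1, by simp⟩ :
        0 < (Finset.univ.filter fun x : Γ => x * y * x⁻¹ = y ^ a).card)
    exact isConj_iff.2 ⟨x, (Finset.mem_filter.1 hx).2⟩
  · intro h
    refine ⟨tamePolynomial w 1, fun K _ _ _ _ hK => ?_⟩
    -- When `y` is conjugate to `y ^ q`, the conjugating elements form a coset of the centralizer of
    -- `y`, whatever `q` is.
    have hpoly : tamePolynomial w 1 = tamePolynomial w (residueCard K) := by
      simp only [tamePolynomial_eq_sum, pow_one, card_conj_eq_of_isConj (h _ _ hK)]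
    exact hpoly ▸ hw K hK
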